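/- Notation. Let $\mathbb D$ be the open unit disk, $\partial\mathbb D$ the unit circle and $|d\xi|$ arc length on it. Arcs $I\subseteq\partial\mathbb D$ are nondegenerate, with or without endpoints, and $\partial\mathbb D$ itself is an arc. Write $|I|=\frac1{2\pi}\int_I|d\xi|$ and $S(I)=\{z\in\mathbb D:\ 1-|I|\le |z|,\ z=|z|\xi \text{ for some } \xi\in I\}$, so $S(\partial\mathbb D)=\mathbb D$. For $\xi\in\partial\mathbb D$ and $z\in\mathbb D$ let $\Gamma(\xi)=\{z\in\mathbb D: |\xi-z|<2(1-|z|)\}$ and $T(z)=\{\xi\in\partial\mathbb D: z\in\Gamma(\xi)\}$. For a measurable $\omega:\partial\mathbb D\to[0,\infty)$ let $\omega(E)=\int_E\omega(\xi)\,|d\xi|$, and say $\omega\in A_1$ if there is a constant $C>0$ with $\frac1{|I|}\int_I\omega\,|d\xi|\le C\operatorname*{ess\,inf}_{I}\omega$ for all arcs $I$. For $0<p<\infty$ let $\|g\|_{L^p(\omega)}=\big(\frac1{2\pi}\int_{\partial\mathbb D}|g|^p\,\omega\,|d\xi|\big)^{1/p}$. Let $H^p(\omega)$ be the set of $f$ in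 the classical Hardy space $H^1$ of $\mathbb D$ whose nontangential boundary function (also denoted by $f$) lies in $L^p(\omega)$, with $\|f\|_{H^p(\omega)}=\|f\|_{L^p(\omega)}$. Theorem. Let $\mu$ and $\nu$ be positive Borel measures on $\mathbb D$ and $\partial\mathbb D$ respectively, and let $\omega$ be a non-negative measurable function on $\partial\mathbb D$ with $$\mu(\{z\in\mathbb D:\nu(T(z))=0\})=0=\mu(\{z\in\mathbb D:\omega(T(z))=0\}).$$ Put $$A_{\mu,\nu}f(\xi)=\int_{\Gamma(\xi)}|f(z)|\,\frac{d\mu(z)}{\nu(T(z))}\quad(\xi\in\partial\mathbb D),\qquad d\mu_\nu^\omega(z)=\frac{\omega(T(z))}{\nu(T(z))}\,d\mu(z).$$ Suppose that $\omega\in A_1$ and $0<p\le q<\infty$. Then $A_{\mu,\nu}:H^p(\omega)\to L^q(\omega)$ is bounded, that is, there is a constant $C>0$ with $\|A_{\mu,\nu}f\|_{L^q(\omega)}\le C\|f\|_{H^p(\omega)}$ for all $f\in H^p(\omega)$, if and only if there is a constant $C>0$ such that for all arcs $I\subseteq\partial\mathbb D$ $$\mu_\nu^\omega(S(I))\le C\,\omega(I)^{1+\frac1p-\frac1q}.$$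 -/

import Mathlib

open MeasureTheory Set Filter Topology
open scoped ENNReal NNReal

noncomputable section

namespace AreaOperator

/-- The open unit disk `𝔻`, with the Borel structure inherited from `ℂ`. -/
abbrev Disk : Type := Metric.ball (0 : ℂ) 1

/-- The unit circle `∂𝔻`, with the Borel structure inherited from `ℂ`. -/
abbrev Torus : Type := Metric.sphere (0 : ℂ) 1

/-- The point `e^{it}` of the unit circle. -/
def expPt (t : ℝ) : Torus :=
  ⟨Complex.exp (t * Complex.I), by simp [Complex.norm_exp_ofReal_mul_I]⟩

/-- Arc length `|dξ|` on the unit circle (total mass `2π`). -/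
def arcLength : Measure Torus :=
  (volume.restrict (Ioc (-Real.pi) Real.pi)).map expPt

/-- Arcs of the circle: images under `t ↦ e^{it}` of nondegenerate intervals of length at most
`2π`, with or without endpoints. The whole circle is an arc. -/
def IsArc (I : Set Torus) : Prop :=
  ∃ (a : ℝ) (J : Set ℝ), J ⊆ Icc a (a + 2 * Real.pi) ∧ J.OrdConnected ∧ J.Nontrivial ∧
    I = expPt '' J

/-- Normalized length `|I| = (1 / 2π) ∫_I |dξ|`. -/
def normLength (I : Set Torus) : ℝ := (arcLength I).toReal / (2 * Real.pi)

/-- `ω(E) = ∫_E ω(ξ) |dξ|`. -/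
def wMass (ω : Torus → ℝ≥0) (E : Set Torus) : ℝ≥0∞ := ∫⁻ ξ in E, (ω ξ : ℝ≥0∞) ∂arcLength

/-- The Muckenhoupt condition `A₁`: the mean of `ω` over each arc is at most a constant times the
(essential) infimum of `ω` over that arc. -/
def IsA1 (ω : Torus → ℝ≥0) : Prop :=
  ∃ C : ℝ≥0, 0 < C ∧ ∀ I : Set Torus, IsArc I →
    wMass ω I / ENNReal.ofReal (normLength I) ≤
      C * essInf (fun ξ => (ω ξ : ℝ≥0∞)) (arcLength.restrict I)

/-- `‖F‖_{L^p(ω)} = ((1 / 2π) ∫ F(ξ)^p ω(ξ) |dξ|)^{1/p}` for an `[0, ∞]`-valued function `F`. -/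
def wNorm (ω : Torus → ℝ≥0) (p : ℝ) (F : Torus → ℝ≥0∞) : ℝ≥0∞ :=
  ((ENNReal.ofReal (2 * Real.pi))⁻¹ * ∫⁻ ξ, F ξ ^ p * (ω ξ : ℝ≥0∞) ∂arcLength) ^ (1 / p)

/-- The approach region `Γ(ξ) = {z ∈ 𝔻 : |ξ - z| < 2 (1 - |z|)}`. -/
def Gam (ξ : Torus) : Set ℂ := {z | ‖z‖ < 1 ∧ ‖(ξ : ℂ) - z‖ < 2 * (1 - ‖z‖)}

/-- `T(z) = {ξ ∈ ∂𝔻 : z ∈ Γ(ξ)}`. -/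
def Tent (z : Disk) : Set Torus := {ξ | (z : ℂ) ∈ Gam ξ}

/-- The Carleson square `S(I) = {z ∈ 𝔻 : 1 - |I| ≤ |z|, z / |z| ∈ I}`. The direction of `z` is
expressed by `z = |z| ξ` with `ξ ∈ I`, so that `S(∂𝔻) = 𝔻`. -/
def carlesonSquare (I : Set Torus) : Set Disk :=
  {z | 1 - normLength I ≤ ‖(z : ℂ)‖ ∧ ∃ ξ ∈ I, (z : ℂ) = (‖(z : ℂ)‖ : ℂ) * (ξ : ℂ)}

/-- Membership in the Hardy space `H¹` of the disk: `f` is analytic on `𝔻` and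
`sup_{0 < r < 1} (1 / 2π) ∫ |f(rξ)| |dξ| < ∞`. -/
def MemH1 (f : ℂ → ℂ) : Prop :=
  DifferentiableOn ℂ f (Metric.ball 0 1) ∧
    (⨆ r ∈ Ioo (0 : ℝ) 1,
      ((ENNReal.ofReal (2 * Real.pi))⁻¹ *
        ∫⁻ ξ : Torus, ‖f ((r : ℂ) * (ξ : ℂ))‖ₑ ∂arcLength)) < ∞

/-- `g` is the boundary function of `f`: for almost every `ξ`, `g ξ` is the nontangential limit
of `f` at `ξ`. (Such a `g` is unique up to null sets.) -/
def IsBoundaryFunction (f : ℂ → ℂ) (g : Torus → ℂ) : Prop :=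
  ∀ᵐ ξ : Torus ∂arcLength, Tendsto f (𝓝[Gam ξ] (ξ : ℂ)) (𝓝 (g ξ))

/-- `f ∈ H^p(ω)`, with boundary function `g`: `f` is in `H¹` and its boundary function `g` is in
`L^p(ω)`. The norm of `f` in `H^p(ω)` is then `wNorm ω p (fun ξ => ‖g ξ‖ₑ)`. -/
def MemWeightedHardy (ω : Torus → ℝ≥0) (p : ℝ) (f : ℂ → ℂ) (g : Torus → ℂ) : Prop :=
  MemH1 f ∧ IsBoundaryFunction f g ∧ wNorm ω p (fun ξ => ‖g ξ‖ₑ) < ∞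

/-- The generalized area operator
`A_{μ,ν} f(ξ) = ∫_{Γ(ξ)} |f(z)| / ν(T(z)) dμ(z)`, as a function with values in `[0, ∞]`. -/
def areaOp (μ : Measure Disk) (ν : Measure Torus) (f : ℂ → ℂ) (ξ : Torus) : ℝ≥0∞ :=
  ∫⁻ z in {z : Disk | (z : ℂ) ∈ Gam ξ}, ‖f z‖ₑ / ν (Tent z) ∂μ

/-- `A_{μ,ν} : H^p(ω) → L^q(ω)` is bounded. -/
def AreaOpBounded (μ : Measure Disk) (ν : Measure Torus) (ω : Torus → ℝ≥0) (p q : ℝ) : Prop :=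
  ∃ C : ℝ≥0, 0 < C ∧ ∀ (f : ℂ → ℂ) (g : Torus → ℂ), MemWeightedHardy ω p f g →
    wNorm ω q (areaOp μ ν f) ≤ C * wNorm ω p (fun ξ => ‖g ξ‖ₑ)

/-- The measure `dμ_ν^ω(z) = ω(T(z)) / ν(T(z)) dμ(z)`. -/
def muNuOmega (μ : Measure Disk) (ν : Measure Torus) (ω : Torus → ℝ≥0) : Measure Disk :=
  μ.withDensity fun z => wMass ω (Tent z) / ν (Tent z)

end AreaOperator

end

/-!
Let `W` be the measure `ω |dξ|` and `m` the measure `dμ(z) / ν(T(z))`. Then `A_{μ,ν} f(ξ)` is the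
integral of `|f|` over `Γ(ξ)` with respect to `m`, and `μ_ν^ω` has density `W(T(z))` with respect to
`m`. An `A₁` weight is doubling, so Carleson squares over arcs can be replaced by boxes
`{z : T(z) ⊆ T(w)}` over tents (`carleson_iff_box`): they are defined by inclusions between tents
only, which turns covering arguments into arguments about subsets of the circle. Throughout,
`t = 1 + 1/p - 1/q ≥ 1`.

**Sufficiency.** The Carleson condition passes from tents to arbitrary subsets of the circle by a
Vitali covering (`measure_box_le`), hence gives the embedding
`∫ F ^ t dμ_ν^ω ≲ (∫ F* dW) ^ t`, where `F*` is the nontangential supremum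
(`lintegral_rpow_le_of_carleson`). For `q > 1` the area function is bounded by duality: Tonelli's
theorem turns `∫ A F · k dW` into the integral of `F` times the averages of `k` over tents, Hölder's
inequality separates the two factors, and the second one is controlled by the maximal theorem
(`lintegral_area_rpow_le_of_one_lt`). For `q ≤ 1`, Hölder's inequality is applied to
`A F ≤ (F*) ^ (1 - s) · A (F ^ s)` for suitable `s` (`lintegral_area_rpow_le_of_le_one`).
It remains to bound `f*` in `L^p(W)` by the boundary function of `f`: small powers `|f| ^ s` are
dominated by the Poisson integral of their boundary values (`MemH1.enorm_rpow_le_lintegral`, after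
division by a Blaschke product), the `A₁` condition dominates Poisson integrals by the maximal
function relative to `W` (`IsA1.exists_lintegral_pk_le`), and the maximal theorem is applied with
exponent `p / s > 1`.

**Necessity.** The functions `((1 - |a|) / (1 - ā z)) ^ k` are of size `1` on the box over `T(a)`
and have `H^p(ω)` norm `≲ W(T(a)) ^ (1/p)`; this tests the area function of the box. To pass from
the `q`-norm of this area function to the measure of the box, which is its `1`-norm even when
`q < 1`, one discards the points `z` for which the area function exceeds a level
`l ≈ W(T(w)) ^ (1/p - 1/q)` on half of `T(z)`: the others contribute at most `2 l W(T(w))` by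
Tonelli, and the discarded ones lie over a set so small that the Carleson constant is reproduced with a
factor `1/2` (`measure_box_le_of_level`, `carleson_le_of_area_le`). The finiteness of the
constant that is needed to absorb it is obtained by restricting to compact disks.
-/

noncomputable section

namespace AreaOperator

/-! ### Arc length and balls of the circle -/

theorem continuous_expPt : Continuous expPt := by
  unfold expPt; fun_prop

theorem expPt_periodic (t : ℝ) : expPt (t + 2 * Real.pi) = expPt t := by
  apply Subtype.ext
  change Complex.exp _ = Complex.exp _
  rw [← Complex.exp_periodic ((t : ℂ) * Complex.I)]
  congr 1; push_cast; ring

theorem dist_expPt (a b : ℝ) : dist (expPt a) (expPt b) = 2 * |Real.sin ((a - b) / 2)| := by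
  have h : (expPt a : ℂ) - expPt b
      = Complex.exp (b * Complex.I) * (Complex.exp (Complex.I * ((a - b : ℝ) : ℂ)) - 1) := by
    change Complex.exp _ - Complex.exp _ = _
    rw [mul_sub, ← Complex.exp_add, mul_one]
    congr 2; push_cast; ring
  rw [Subtype.dist_eq, dist_eq_norm, h, norm_mul, Complex.norm_exp_ofReal_mul_I, one_mul,
    Complex.norm_exp_I_mul_ofReal_sub_one]
  simp

theorem dist_expPt_le (a b : ℝ) : dist (expPt a) (expPt b) ≤ |a - b| := by
  rw [dist_expPt]
  have h : |Real.sin ((a - b) / 2)| ≤ |(a - b) / 2| := Real.abs_sin_le_abs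
  rw [abs_div, abs_two] at h
  linarith

theorem le_dist_expPt {a b : ℝ} (h : |a - b| ≤ Real.pi) :
    2 / Real.pi * |a - b| ≤ dist (expPt a) (expPt b) := by
  rw [dist_expPt]
  have h1 : |(a - b) / 2| ≤ Real.pi / 2 := by rw [abs_div, abs_two]; linarith
  have h2 := Real.mul_abs_le_abs_sin h1
  rw [abs_div, abs_two] at h2
  linarith

/-- Every point of the circle has an argument in a prescribed window of length `2π`. -/
theorem exists_expPt_eq (a : ℝ) (ξ : Torus) : ∃ t, |t - a| ≤ Real.pi ∧ expPt t = ξ := by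
  have hξ : ‖(ξ : ℂ)‖ = 1 := mem_sphere_zero_iff_norm.1 ξ.2
  have h0 : expPt (Complex.arg ξ) = ξ := by
    apply Subtype.ext
    have := Complex.norm_mul_exp_arg_mul_I (ξ : ℂ)
    rw [hξ] at this
    simpa [expPt] using this
  have hper : Function.Periodic expPt (2 * Real.pi) := expPt_periodic
  obtain ⟨y, hy, hy'⟩ := hper.exists_mem_Ioc (by positivity) (Complex.arg ξ) (a - Real.pi)
  refine ⟨y, ?_, by rw [← hy', h0]⟩
  rw [abs_le]; constructor <;> [linarith [hy.1]; linarith [hy.2]]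

theorem arcLength_apply {E : Set Torus} (hE : MeasurableSet E) (c : ℝ) :
    arcLength E = volume (expPt ⁻¹' E ∩ Ioc c (c + 2 * Real.pi)) := by
  have hm : MeasurableSet (expPt ⁻¹' E) := continuous_expPt.measurable hE
  rw [arcLength, Measure.map_apply continuous_expPt.measurable hE, Measure.restrict_apply hm]
  have hpos : (0 : ℝ) < 2 * Real.pi := by positivity
  have h1 := isAddFundamentalDomain_Ioc hpos c
  have h2 := isAddFundamentalDomain_Ioc hpos (-Real.pi)
  have e : -Real.pi + 2 * Real.pi = Real.pi := by ring
  rw [e] at h2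
  refine h2.measure_set_eq h1 hm fun g => ?_
  ext x
  have hper : Function.Periodic expPt (2 * Real.pi) := expPt_periodic
  obtain ⟨g, n, rfl⟩ := g
  simp only [mem_preimage]
  change expPt (n • (2 * Real.pi) + x) ∈ E ↔ _
  rw [add_comm, hper.zsmul n]

theorem arcLength_univ : arcLength univ = ENNReal.ofReal (2 * Real.pi) := by
  rw [arcLength_apply MeasurableSet.univ 0]; simp

instance : IsFiniteMeasure arcLength := ⟨by rw [arcLength_univ]; exact ENNReal.ofReal_lt_top⟩

theorem arcLength_ball_le (η : Torus) (R : ℝ) :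
    arcLength (Metric.ball η R) ≤ ENNReal.ofReal (Real.pi * R) := by
  obtain ⟨a, -, rfl⟩ := exists_expPt_eq 0 η
  rw [arcLength_apply Metric.isOpen_ball.measurableSet (a - Real.pi)]
  calc _ ≤ volume (Icc (a - Real.pi * R / 2) (a + Real.pi * R / 2)) := by
        refine measure_mono fun t ht => ?_
        have h1 : |t - a| ≤ Real.pi := by
          rw [abs_le]; constructor <;> [linarith [ht.2.1]; linarith [ht.2.2]]
        have h2 := (le_dist_expPt h1).trans_lt ht.1
        have h3 : |t - a| ≤ Real.pi * R / 2 := by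
          rw [div_mul_eq_mul_div, div_lt_iff₀ Real.pi_pos] at h2
          linarith
        rw [abs_le] at h3
        exact ⟨by linarith, by linarith⟩
    _ = _ := by rw [Real.volume_Icc]; congr 1; ring

theorem le_arcLength_ball (η : Torus) {R : ℝ} (hR : R ≤ Real.pi) :
    ENNReal.ofReal (2 * R) ≤ arcLength (Metric.ball η R) := by
  obtain ⟨a, -, rfl⟩ := exists_expPt_eq 0 η
  rw [arcLength_apply Metric.isOpen_ball.measurableSet (a - Real.pi)]
  calc _ = volume (Ioo (a - R) (a + R)) := by rw [Real.volume_Ioo]; congr 1; ring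
    _ ≤ _ := by
        refine measure_mono fun t ht => ⟨?_, by linarith [ht.1], by linarith [ht.2]⟩
        refine (dist_expPt_le t a).trans_lt ?_
        rw [abs_lt]; constructor <;> [linarith [ht.1]; linarith [ht.2]]

theorem dist_torus_le (ξ η : Torus) : dist ξ η ≤ 2 := by
  obtain ⟨a, -, rfl⟩ := exists_expPt_eq 0 ξ
  obtain ⟨b, -, rfl⟩ := exists_expPt_eq 0 η
  rw [dist_expPt]; linarith [Real.abs_sin_le_one ((a - b) / 2)]

theorem ball_eq_univ (η : Torus) {R : ℝ} (hR : 2 < R) : Metric.ball η R = univ :=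
  eq_univ_of_forall fun ξ => (dist_torus_le ξ η).trans_lt hR

/-- The closed arc centred at `expPt a` of half-length `θ`. -/
def arc (a θ : ℝ) : Set Torus := expPt '' Icc (a - θ) (a + θ)

theorem isArc_arc (a : ℝ) {θ : ℝ} (h0 : 0 < θ) (h1 : θ ≤ Real.pi) : IsArc (arc a θ) :=
  ⟨a - θ, _, Icc_subset_Icc le_rfl (by linarith), ordConnected_Icc,
    ⟨a - θ, left_mem_Icc.2 (by linarith), a + θ, right_mem_Icc.2 (by linarith), by linarith⟩, rfl⟩

theorem ball_subset_arc (a : ℝ) {θ : ℝ} : Metric.ball (expPt a) (2 / Real.pi * θ) ⊆ arc a θ := by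
  intro ξ hξ
  obtain ⟨t, ht, rfl⟩ := exists_expPt_eq a ξ
  have h2 := (le_dist_expPt ht).trans_lt hξ
  have h3 : |t - a| < θ := lt_of_mul_lt_mul_left h2 (by positivity)
  rw [abs_lt] at h3
  exact ⟨t, ⟨by linarith, by linarith⟩, rfl⟩

theorem arc_subset_ball (a : ℝ) {θ R : ℝ} (h : θ < R) : arc a θ ⊆ Metric.ball (expPt a) R := by
  rintro _ ⟨t, ht, rfl⟩
  refine (dist_expPt_le t a).trans_lt (lt_of_le_of_lt ?_ h)
  rw [abs_le]; constructor <;> [linarith [ht.1]; linarith [ht.2]]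

theorem arc_pi (a : ℝ) : arc a Real.pi = univ := by
  refine eq_univ_of_forall fun ξ => ?_
  obtain ⟨t, ht, rfl⟩ := exists_expPt_eq a ξ
  rw [abs_le] at ht
  exact ⟨t, ⟨by linarith, by linarith⟩, rfl⟩

/-- Every arc is comparable to a ball. -/
theorem IsArc.exists_ball {I : Set Torus} (hI : IsArc I) :
    ∃ (η : Torus) (L : ℝ), 0 < L ∧ L ≤ 2 * Real.pi ∧ Metric.ball η (L / Real.pi) ⊆ I ∧
      I ⊆ Metric.ball η L := by
  obtain ⟨a, J, hJ, hc, hn, rfl⟩ := hI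
  have hbb : BddBelow J := ⟨a, fun x hx => (hJ hx).1⟩
  have hba : BddAbove J := ⟨a + 2 * Real.pi, fun x hx => (hJ hx).2⟩
  have hne : J.Nonempty := hn.nonempty
  set α := sInf J
  set β := sSup J
  have hαβ : α < β := by
    obtain ⟨x, hx, y, hy, hxy⟩ := hn.exists_lt
    exact (csInf_le hbb hx).trans_lt (hxy.trans_le (le_csSup hba hy))
  have h1 : a ≤ α := le_csInf hne fun x hx => (hJ hx).1
  have h2 : β ≤ a + 2 * Real.pi := csSup_le hne fun x hx => (hJ hx).2
  refine ⟨expPt ((α + β) / 2), β - α, by linarith, by linarith, ?_, ?_⟩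
  · intro ξ hξ
    obtain ⟨t, ht, rfl⟩ := exists_expPt_eq ((α + β) / 2) ξ
    have h3 := (le_dist_expPt ht).trans_lt hξ
    rw [div_mul_eq_mul_div, div_lt_div_iff_of_pos_right Real.pi_pos] at h3
    have h4 : |t - (α + β) / 2| < (β - α) / 2 := by linarith
    rw [abs_lt] at h4
    obtain ⟨x, hx, hxt⟩ := exists_lt_of_csInf_lt hne (show α < t by linarith)
    obtain ⟨y, hy, hty⟩ := exists_lt_of_lt_csSup hne (show t < β by linarith)
    exact ⟨t, hc.out hx hy ⟨hxt.le, hty.le⟩, rfl⟩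
  · rintro _ ⟨t, ht, rfl⟩
    have h3 := csInf_le hbb ht
    have h4 := le_csSup hba ht
    refine (dist_expPt_le _ _).trans_lt ?_
    rw [abs_lt]; constructor <;> linarith

/-! ### Tents over points of the disk -/

/-- The point of the disk at distance `min d 1` from the circle in the direction `η`, for `d > 0`;
the value `0` for `d ≤ 0` is irrelevant. -/
def radial (η : Torus) (d : ℝ) : Disk :=
  if h : 0 < d then
    ⟨((max (1 - d) 0 : ℝ) : ℂ) * η, by
      have hη : ‖(η : ℂ)‖ = 1 := mem_sphere_zero_iff_norm.1 η.2
      rw [mem_ball_zero_iff, norm_mul, hη, mul_one, Complex.norm_real, Real.norm_eq_abs,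
        abs_of_nonneg (le_max_right _ _)]
      exact max_lt (by linarith) one_pos⟩
  else 0

theorem norm_torus (η : Torus) : ‖(η : ℂ)‖ = 1 := mem_sphere_zero_iff_norm.1 η.2

theorem norm_disk_lt (z : Disk) : ‖(z : ℂ)‖ < 1 := mem_ball_zero_iff.1 z.2

theorem coe_radial (η : Torus) {d : ℝ} (hd : 0 < d) :
    (radial η d : ℂ) = ((max (1 - d) 0 : ℝ) : ℂ) * η := by
  rw [radial, dif_pos hd]

theorem norm_radial (η : Torus) {d : ℝ} (hd : 0 < d) : ‖(radial η d : ℂ)‖ = max (1 - d) 0 := by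
  rw [coe_radial η hd, norm_mul, norm_torus, mul_one, Complex.norm_real, Real.norm_eq_abs,
    abs_of_nonneg (le_max_right _ _)]

theorem exists_radial_eq (z : Disk) : ∃ η, radial η (1 - ‖(z : ℂ)‖) = z := by
  have hz := norm_disk_lt z
  by_cases h : (z : ℂ) = 0
  · refine ⟨expPt 0, Subtype.ext ?_⟩
    rw [coe_radial _ (by linarith), h]; simp
  · refine ⟨⟨(z : ℂ) / ‖(z : ℂ)‖, by simp [h]⟩, Subtype.ext ?_⟩
    rw [coe_radial _ (by linarith)]
    have : max (1 - (1 - ‖(z : ℂ)‖)) 0 = ‖(z : ℂ)‖ := by simp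
    rw [this]
    have : (‖(z : ℂ)‖ : ℂ) ≠ 0 := by simpa using h
    field_simp

theorem mem_tent {z : Disk} {ξ : Torus} :
    ξ ∈ Tent z ↔ ‖(ξ : ℂ) - z‖ < 2 * (1 - ‖(z : ℂ)‖) :=
  ⟨fun h => h.2, fun h => ⟨norm_disk_lt z, h⟩⟩

theorem norm_torus_sub_radial (η : Torus) {d : ℝ} (hd : 0 < d) :
    ‖(η : ℂ) - radial η d‖ = 1 - ‖(radial η d : ℂ)‖ := by
  rw [norm_radial η hd, coe_radial η hd]
  have : (η : ℂ) - ((max (1 - d) 0 : ℝ) : ℂ) * η = ((1 - max (1 - d) 0 : ℝ) : ℂ) * η := by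
    push_cast; ring
  rw [this, norm_mul, norm_torus, mul_one, Complex.norm_real, Real.norm_eq_abs, abs_of_nonneg]
  have : max (1 - d) 0 ≤ 1 := max_le (by linarith) zero_le_one
  linarith

theorem one_sub_norm_radial (η : Torus) {d : ℝ} (hd : 0 < d) :
    1 - ‖(radial η d : ℂ)‖ = min d 1 := by
  rw [norm_radial η hd]
  rcases le_total d 1 with h | h
  · rw [max_eq_left (by linarith), min_eq_left h]; ring
  · rw [max_eq_right (by linarith), min_eq_right h]; ring

theorem dist_coe (ξ η : Torus) : dist ξ η = ‖(ξ : ℂ) - η‖ := by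
  rw [Subtype.dist_eq, dist_eq_norm]

theorem tent_radial_eq_univ (η : Torus) {d : ℝ} (hd : 1 ≤ d) : Tent (radial η d) = univ := by
  refine eq_univ_of_forall fun ξ => ?_
  have h0 : (radial η d : ℂ) = 0 := by
    rw [coe_radial η (by linarith), max_eq_right (by linarith)]; simp
  rw [mem_tent, h0]; simp

theorem ball_subset_tent (η : Torus) {d : ℝ} (hd : 0 < d) :
    Metric.ball η d ⊆ Tent (radial η d) := by
  rcases le_total 1 d with h | h
  · rw [tent_radial_eq_univ η h]; exact subset_univ _
  intro ξ hξ
  rw [Metric.mem_ball, dist_coe] at hξ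
  have h1 := norm_torus_sub_radial η hd
  rw [mem_tent]
  have h2 := norm_sub_le_norm_sub_add_norm_sub (ξ : ℂ) η (radial η d)
  rw [one_sub_norm_radial η hd, min_eq_left h] at *
  linarith

theorem tent_subset_ball (η : Torus) {d : ℝ} (hd : 0 < d) :
    Tent (radial η d) ⊆ Metric.ball η (3 * d) := by
  intro ξ hξ
  rw [Metric.mem_ball, dist_coe]
  rw [mem_tent] at hξ
  have h1 := norm_torus_sub_radial η hd
  rw [norm_sub_rev] at h1
  have h2 := norm_sub_le_norm_sub_add_norm_sub (ξ : ℂ) (radial η d) η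
  rw [one_sub_norm_radial η hd] at *
  have := min_le_left d 1
  linarith

theorem tent_radial_mono (η : Torus) {d D : ℝ} (hd : 0 < d) (h : d ≤ D) :
    Tent (radial η d) ⊆ Tent (radial η D) := by
  rcases le_total 1 D with h1 | h1
  · rw [tent_radial_eq_univ η h1]; exact subset_univ _
  intro ξ hξ
  rw [mem_tent, one_sub_norm_radial η hd, min_eq_left (by linarith)] at hξ
  rw [mem_tent, one_sub_norm_radial η (by linarith), min_eq_left h1]
  have e : (radial η d : ℂ) - radial η D = ((D - d : ℝ) : ℂ) * η := by
    rw [coe_radial η hd, coe_radial η (by linarith), max_eq_left (by linarith),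
      max_eq_left (by linarith)]
    push_cast; ring
  have h2 := norm_sub_le_norm_sub_add_norm_sub (ξ : ℂ) (radial η d) (radial η D)
  rw [e, norm_mul, norm_torus, mul_one, Complex.norm_real, Real.norm_eq_abs,
    abs_of_nonneg (by linarith)] at h2
  linarith

theorem isOpen_setOf_mem_tent : IsOpen {x : Torus × Disk | x.1 ∈ Tent x.2} := by
  simp only [mem_tent]
  exact isOpen_lt (by fun_prop) (by fun_prop)

theorem isOpen_tent (z : Disk) : IsOpen (Tent z) :=
  isOpen_setOf_mem_tent.preimage (f := fun ξ : Torus => (ξ, z)) (by fun_prop)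

theorem measurableSet_tent (z : Disk) : MeasurableSet (Tent z) := (isOpen_tent z).measurableSet

theorem isOpen_setOf_tent (ξ : Torus) : IsOpen {z : Disk | ξ ∈ Tent z} :=
  isOpen_setOf_mem_tent.preimage (f := fun z : Disk => (ξ, z)) (by fun_prop)

theorem tent_nonempty (z : Disk) : (Tent z).Nonempty := by
  obtain ⟨η, hη⟩ := exists_radial_eq z
  have hd : 0 < 1 - ‖(z : ℂ)‖ := by linarith [norm_disk_lt z]
  rw [← hη]
  exact ⟨η, ball_subset_tent η hd (Metric.mem_ball_self hd)⟩

/-- The measure of the tent over `z` depends on `z` in a lower semicontinuous, hence measurable,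
way; the measure need not be σ-finite. -/
theorem lowerSemicontinuous_measure_tent (V : Measure Torus) :
    LowerSemicontinuous fun z => V (Tent z) := by
  refine lowerSemicontinuous_iff_le_liminf.2 fun z => ?_
  have hm : ∀ z : Disk, Measurable ((Tent z).indicator (fun _ => (1 : ℝ≥0∞))) := fun z =>
    measurable_const.indicator (measurableSet_tent z)
  have hV : ∀ z : Disk, V (Tent z) = ∫⁻ ξ, (Tent z).indicator (fun _ => (1 : ℝ≥0∞)) ξ ∂V :=
    fun z => by rw [lintegral_indicator_const (measurableSet_tent z), one_mul]
  simp_rw [hV]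
  refine le_trans (lintegral_mono fun ξ => ?_) (lintegral_liminf_le (u := 𝓝 z) hm)
  by_cases h : ξ ∈ Tent z
  · rw [indicator_of_mem h]
    refine le_liminf_of_le (by isBoundedDefault) ?_
    filter_upwards [(isOpen_setOf_tent ξ).mem_nhds h] with w hw
    rw [indicator_of_mem hw]
  · rw [indicator_of_notMem h]; exact zero_le

theorem measurable_measure_tent (V : Measure Torus) : Measurable fun z => V (Tent z) :=
  (lowerSemicontinuous_measure_tent V).measurable

/-- Tents meeting a tent of at least half their height lie in a fixed enlargement of it. -/
theorem tent_subset_of_inter_nonempty {η ζ : Torus} {d e : ℝ} (hd : 0 < d) (he : 0 < e)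
    (h : (Tent (radial η d) ∩ Tent (radial ζ e)).Nonempty) (hde : d ≤ 2 * e) :
    Tent (radial η d) ⊆ Tent (radial ζ (15 * e)) := by
  obtain ⟨x, hx1, hx2⟩ := h
  refine Subset.trans (fun ξ hξ => ?_) (ball_subset_tent ζ (by positivity))
  have h1 := tent_subset_ball η hd hx1
  have h2 := tent_subset_ball ζ he hx2
  have h3 := tent_subset_ball η hd hξ
  rw [Metric.mem_ball] at *
  have h4 := dist_triangle ξ η ζ
  have h5 := dist_triangle η x ζ
  rw [dist_comm η x] at h5
  linarith

/-! ### The weighted measure of an `A₁` weight -/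

/-- The measure `ω(ξ) |dξ|`. -/
def weighted (ω : Torus → ℝ≥0) : Measure Torus := arcLength.withDensity fun ξ => (ω ξ : ℝ≥0∞)

theorem wMass_eq (ω : Torus → ℝ≥0) (E : Set Torus) : wMass ω E = weighted ω E := by
  rw [wMass, weighted, withDensity_apply']

theorem arcLength_ne_zero : arcLength ≠ 0 := fun h => by
  have := arcLength_univ
  rw [h] at this
  simp [Real.pi_pos.not_ge] at this

/-- The `A₁` condition on balls: the mass of a ball is controlled by any of its subsets through a
lower bound `c` of the weight on the ball. -/
theorem IsA1.exists_lower_bound {ω : Torus → ℝ≥0} (h : IsA1 ω) :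
    ∃ C : ℝ≥0, ∀ (η : Torus) (R : ℝ), 0 < R → ∃ c : ℝ≥0∞,
      (∀ᵐ ξ ∂arcLength.restrict (Metric.ball η R), c ≤ ω ξ) ∧
        weighted ω (Metric.ball η R) ≤ C * ENNReal.ofReal R * c := by
  obtain ⟨C, -, hC⟩ := h
  refine ⟨C * 2, fun η R hR => ?_⟩
  obtain ⟨a, -, rfl⟩ := exists_expPt_eq 0 η
  obtain ⟨θ, h0, h1, h2, h3⟩ : ∃ θ : ℝ, 0 < θ ∧ θ ≤ Real.pi ∧ θ ≤ Real.pi * R / 2 ∧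
      Metric.ball (expPt a) R ⊆ arc a θ := by
    rcases le_total R 2 with h | h
    · refine ⟨Real.pi * R / 2, by positivity, by nlinarith [Real.pi_pos], le_rfl, ?_⟩
      have := ball_subset_arc a (θ := Real.pi * R / 2)
      rwa [show 2 / Real.pi * (Real.pi * R / 2) = R by field_simp] at this
    · exact ⟨Real.pi, Real.pi_pos, le_rfl, by nlinarith [Real.pi_pos], by
        rw [arc_pi]; exact subset_univ _⟩
  have hfin : arcLength (arc a θ) ≠ ∞ := measure_ne_top _ _
  have hpos : 0 < normLength (arc a θ) := by
    refine div_pos (ENNReal.toReal_pos ?_ hfin) (by positivity)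
    refine ne_of_gt (lt_of_lt_of_le ?_ (measure_mono (ball_subset_arc a)))
    refine lt_of_lt_of_le ?_ (le_arcLength_ball _ ?_)
    · rw [ENNReal.ofReal_pos]; positivity
    · rw [div_mul_eq_mul_div, div_le_iff₀ Real.pi_pos]; nlinarith [Real.pi_gt_three]
  have hle : normLength (arc a θ) ≤ 2 * R := by
    rw [normLength, div_le_iff₀ (by positivity)]
    refine ENNReal.toReal_le_of_le_ofReal (by positivity) ?_
    refine (measure_mono (arc_subset_ball a (show θ < 2 * θ by linarith))).trans
      ((arcLength_ball_le _ _).trans (ENNReal.ofReal_le_ofReal ?_))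
    nlinarith [Real.pi_lt_four, Real.pi_pos, mul_pos Real.pi_pos hR]
  set c := essInf (fun ξ => (ω ξ : ℝ≥0∞)) (arcLength.restrict (arc a θ))
  refine ⟨c, ?_, ?_⟩
  · have : ∀ᵐ ξ ∂arcLength.restrict (arc a θ), c ≤ ω ξ := ae_essInf_le
    exact ae_restrict_of_ae_restrict_of_subset h3 this
  · have h4 := hC _ (isArc_arc a h0 h1)
    rw [ENNReal.div_le_iff (by simpa using hpos) ENNReal.ofReal_ne_top, wMass_eq] at h4
    refine (measure_mono h3).trans (h4.trans ?_)
    calc C * c * ENNReal.ofReal (normLength (arc a θ))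
        ≤ C * c * ENNReal.ofReal (2 * R) := by gcongr
      _ = _ := by
        rw [ENNReal.ofReal_mul (by norm_num), ENNReal.ofReal_ofNat]; push_cast; ring

theorem IsA1.isFiniteMeasure {ω : Torus → ℝ≥0} (h : IsA1 ω) : IsFiniteMeasure (weighted ω) := by
  obtain ⟨C, hC⟩ := h.exists_lower_bound
  obtain ⟨c, hc, hc'⟩ := hC (expPt 0) 3 (by norm_num)
  rw [ball_eq_univ _ (by norm_num)] at hc hc'
  rw [Measure.restrict_univ] at hc
  have : (ae arcLength).NeBot := ae_neBot.2 arcLength_ne_zero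
  obtain ⟨ξ, hξ⟩ := hc.exists
  refine ⟨hc'.trans_lt (ENNReal.mul_lt_top (ENNReal.mul_lt_top ENNReal.coe_lt_top
    ENNReal.ofReal_lt_top) (hξ.trans_lt ENNReal.coe_lt_top))⟩

theorem const_mul_le_weighted {ω : Torus → ℝ≥0} {A B : Set Torus} {c : ℝ≥0∞} (hAB : A ⊆ B)
    (hc : ∀ᵐ ξ ∂arcLength.restrict B, c ≤ ω ξ) : c * arcLength A ≤ weighted ω A := by
  rw [weighted, withDensity_apply', ← setLIntegral_const]
  exact lintegral_mono_ae (ae_restrict_of_ae_restrict_of_subset hAB hc)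

/-- The `A_∞`-type comparison of `ω(ξ) |dξ|` and arc length on subsets of a ball. -/
theorem IsA1.weighted_mul_le {ω : Torus → ℝ≥0} (h : IsA1 ω) :
    ∃ C : ℝ≥0, ∀ (η : Torus) (R : ℝ), 0 < R → ∀ A ⊆ Metric.ball η R,
      weighted ω (Metric.ball η R) * arcLength A ≤ C * ENNReal.ofReal R * weighted ω A := by
  obtain ⟨C, hC⟩ := h.exists_lower_bound
  refine ⟨C, fun η R hR A hA => ?_⟩
  obtain ⟨c, hc, hc'⟩ := hC η R hR
  calc _ ≤ C * ENNReal.ofReal R * c * arcLength A := by gcongr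
    _ = C * ENNReal.ofReal R * (c * arcLength A) := by ring
    _ ≤ _ := by gcongr; exact const_mul_le_weighted hA hc

/-- A measure on the circle is doubling with constant `D`. The dilation factor is `64`, which
exceeds every ratio of radii that occurs in the comparisons of arcs, balls and tents. -/
def Doubling (W : Measure Torus) (D : ℝ≥0) : Prop :=
  ∀ (η : Torus) (R : ℝ), 0 < R → W (Metric.ball η (64 * R)) ≤ D * W (Metric.ball η R)

theorem IsA1.exists_doubling {ω : Torus → ℝ≥0} (h : IsA1 ω) : ∃ D, Doubling (weighted ω) D := by
  obtain ⟨C, hC⟩ := h.weighted_mul_le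
  refine ⟨C * 32 + 1, fun η R hR => ?_⟩
  rcases le_or_gt R Real.pi with hπ | hπ
  · have h1 := hC η (64 * R) (by positivity) (Metric.ball η R)
      (Metric.ball_subset_ball (by linarith))
    have h2 := le_arcLength_ball η hπ
    have h3 : ENNReal.ofReal (2 * R) ≠ 0 := by simpa using hR
    have h4 : weighted ω (Metric.ball η (64 * R)) * ENNReal.ofReal (2 * R) ≤
        C * 32 * weighted ω (Metric.ball η R) * ENNReal.ofReal (2 * R) := by
      refine (mul_le_mul_right h2 _).trans (h1.trans (le_of_eq ?_))
      rw [show 64 * R = 32 * (2 * R) by ring, ENNReal.ofReal_mul (p := 32) (by norm_num),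
        ENNReal.ofReal_ofNat]
      ring
    rw [ENNReal.mul_le_mul_iff_left h3 ENNReal.ofReal_ne_top] at h4
    refine h4.trans ?_
    push_cast
    gcongr
    exact le_self_add
  · rw [ball_eq_univ η (R := R) (by linarith [Real.pi_gt_three])]
    refine (measure_mono (subset_univ _)).trans ?_
    push_cast
    exact le_mul_of_one_le_left' le_add_self

theorem Doubling.ball_le {W : Measure Torus} {D : ℝ≥0} (h : Doubling W D) {η : Torus} {R S : ℝ}
    (hR : 0 < R) (hS : S ≤ 64 * R) : W (Metric.ball η S) ≤ D * W (Metric.ball η R) :=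
  (measure_mono (Metric.ball_subset_ball hS)).trans (h η R hR)

/-! ### Carleson boxes -/

/-- The points of the disk whose tent lies in `U`. -/
def box (U : Set Torus) : Set Disk := {z | Tent z ⊆ U}

theorem one_sub_norm_le_of_tent_subset {z : Disk} {η : Torus} {d : ℝ} (hd : 0 < d)
    (h : Tent z ⊆ Tent (radial η d)) : 1 - ‖(z : ℂ)‖ ≤ 5 * d := by
  obtain ⟨ζ, hζ⟩ := exists_radial_eq z
  have hz : 0 < 1 - ‖(z : ℂ)‖ := by linarith [norm_disk_lt z]
  have h1 : 1 - ‖(z : ℂ)‖ ≤ Real.pi := by linarith [norm_nonneg (z : ℂ), Real.pi_gt_three]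
  have h2 := le_arcLength_ball ζ h1
  have h3 : Metric.ball ζ (1 - ‖(z : ℂ)‖) ⊆ Metric.ball η (3 * d) :=
    ((ball_subset_tent ζ hz).trans (by rw [hζ]; exact h)).trans (tent_subset_ball η hd)
  have h4 := h2.trans ((measure_mono h3).trans (arcLength_ball_le _ _))
  rw [ENNReal.ofReal_le_ofReal_iff (by positivity)] at h4
  nlinarith [Real.pi_lt_d2]

theorem normLength_univ : normLength univ = 1 := by
  rw [normLength, arcLength_univ, ENNReal.toReal_ofReal (by positivity), div_self (by positivity)]

/-- Carleson boxes over tents lie in Carleson squares over comparable arcs. -/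
theorem exists_box_subset_carlesonSquare (η : Torus) {d : ℝ} (hd : 0 < d) :
    ∃ I, IsArc I ∧ I ⊆ Metric.ball η (64 * d) ∧ box (Tent (radial η d)) ⊆ carlesonSquare I := by
  obtain ⟨a, -, rfl⟩ := exists_expPt_eq 0 η
  rcases le_total Real.pi (50 * d) with h | h
  · refine ⟨_, isArc_arc a Real.pi_pos le_rfl, arc_subset_ball a (by linarith), fun z _ => ?_⟩
    obtain ⟨ζ, hζ⟩ := exists_radial_eq z
    have hz : 0 < 1 - ‖(z : ℂ)‖ := by linarith [norm_disk_lt z]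
    rw [arc_pi]
    refine ⟨by rw [normLength_univ]; simp, ζ, mem_univ _, ?_⟩
    have := coe_radial ζ hz
    rwa [hζ, sub_sub_cancel, max_eq_left (norm_nonneg _)] at this
  · refine ⟨_, isArc_arc a (by positivity) h, arc_subset_ball a (by linarith), fun z hz' => ?_⟩
    obtain ⟨ζ, hζ⟩ := exists_radial_eq z
    have hz : 0 < 1 - ‖(z : ℂ)‖ := by linarith [norm_disk_lt z]
    have h1 := one_sub_norm_le_of_tent_subset hd hz'
    have hπ : (2 / Real.pi * (50 * d)) * Real.pi = 100 * d := by field_simp; ring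
    have h2 : 3 * d ≤ 2 / Real.pi * (50 * d) := by
      refine le_of_mul_le_mul_right ?_ Real.pi_pos
      rw [hπ]; nlinarith [Real.pi_lt_four]
    have h3 : 5 * d ≤ normLength (arc a (50 * d)) := by
      rw [normLength, le_div_iff₀ (by positivity)]
      refine (ENNReal.ofReal_le_iff_le_toReal (measure_ne_top _ _)).1 ?_
      refine le_trans ?_ (measure_mono (ball_subset_arc a))
      refine le_trans (ENNReal.ofReal_le_ofReal ?_) (le_arcLength_ball _ ?_)
      · refine le_of_mul_le_mul_right ?_ Real.pi_pos
        rw [mul_assoc 2 _ Real.pi, hπ]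
        have : Real.pi * Real.pi ≤ 16 := by nlinarith [Real.pi_lt_four, Real.pi_pos]
        nlinarith
      · refine le_of_mul_le_mul_right ?_ Real.pi_pos
        rw [hπ]; nlinarith [Real.pi_gt_three]
    refine ⟨by linarith, ζ, ball_subset_arc a (Metric.ball_subset_ball h2 ?_), ?_⟩
    · refine tent_subset_ball _ hd (hz' ?_)
      nth_rw 1 [← hζ]
      exact ball_subset_tent ζ hz (Metric.mem_ball_self hz)
    · have := coe_radial ζ hz
      rwa [hζ, sub_sub_cancel, max_eq_left (norm_nonneg _)] at this

/-- Carleson squares lie in Carleson boxes over comparable tents. -/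
theorem carlesonSquare_subset_box {I : Set Torus} {η : Torus} {L : ℝ} (hL : 0 < L)
    (hI : I ⊆ Metric.ball η L) : carlesonSquare I ⊆ box (Tent (radial η (3 * L))) := by
  rintro z ⟨h1, ζ, hζ, hz⟩
  have hd : 0 < 1 - ‖(z : ℂ)‖ := by linarith [norm_disk_lt z]
  have hzr : radial ζ (1 - ‖(z : ℂ)‖) = z := by
    apply Subtype.ext
    rw [coe_radial ζ hd, sub_sub_cancel, max_eq_left (norm_nonneg _), ← hz]
  have h2 : normLength I ≤ L / 2 := by
    rw [normLength, div_le_iff₀ (by positivity)]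
    refine ENNReal.toReal_le_of_le_ofReal (by positivity) ?_
    refine (measure_mono hI).trans ((arcLength_ball_le _ _).trans (ENNReal.ofReal_le_ofReal ?_))
    linarith
  change Tent z ⊆ _
  rw [← hzr]
  refine (tent_subset_ball ζ hd).trans (Subset.trans ?_ (ball_subset_tent η (by positivity)))
  have := hI hζ
  rw [Metric.mem_ball] at this
  exact Metric.ball_subset_ball' (by linarith)

/-- For a doubling measure `W`, the Carleson condition may be tested on boxes over tents. -/
theorem carleson_iff_box {W : Measure Torus} {D : ℝ≥0} (hD : Doubling W D) (τ : Measure Disk)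
    {t : ℝ} (ht : 0 ≤ t) :
    (∃ C : ℝ≥0, 0 < C ∧ ∀ I, IsArc I → τ (carlesonSquare I) ≤ C * W I ^ t) ↔
      ∃ C : ℝ≥0, ∀ w, τ (box (Tent w)) ≤ C * W (Tent w) ^ t := by
  have key : ∀ {C : ℝ≥0} {x y : ℝ≥0∞}, x ≤ D * y →
      (C : ℝ≥0∞) * x ^ t ≤ (C * D ^ t + 1 : ℝ≥0) * y ^ t := by
    intro C x y hxy
    calc (C : ℝ≥0∞) * x ^ t ≤ C * (D * y) ^ t := by gcongr
      _ = (C * D ^ t : ℝ≥0) * y ^ t := by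
        rw [ENNReal.mul_rpow_of_nonneg _ _ ht, ENNReal.coe_mul,
          ENNReal.coe_rpow_of_nonneg _ ht, mul_assoc]
      _ ≤ _ := by gcongr; exact le_self_add
  constructor
  · rintro ⟨C, -, hC⟩
    refine ⟨C * D ^ t + 1, fun w => ?_⟩
    obtain ⟨η, hη⟩ := exists_radial_eq w
    have hd : 0 < 1 - ‖(w : ℂ)‖ := by linarith [norm_disk_lt w]
    obtain ⟨I, hI, hI1, hI2⟩ := exists_box_subset_carlesonSquare η hd
    rw [← hη]
    refine (measure_mono hI2).trans ((hC I hI).trans (key ?_))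
    refine (measure_mono hI1).trans ((hD η _ hd).trans ?_)
    gcongr
    exact ball_subset_tent η hd
  · rintro ⟨C, hC⟩
    refine ⟨C * D ^ t + 1, by positivity, fun I hI => ?_⟩
    obtain ⟨η, L, hL, -, h1, h2⟩ := hI.exists_ball
    refine (measure_mono (carlesonSquare_subset_box hL h2)).trans ((hC _).trans (key ?_))
    refine (measure_mono (tent_subset_ball η (by positivity))).trans
      ((hD.ball_le (R := L / Real.pi) (by positivity) ?_).trans ?_)
    · rw [mul_div_assoc', le_div_iff₀ Real.pi_pos]; nlinarith [Real.pi_lt_four]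
    · gcongr

/-! ### Coverings by tents -/

/-- The point in the direction of `z` at `15` times its distance to the circle (or the origin). Its
tent contains every tent of at most twice the height that meets the tent over `z`. -/
def enlarge (z : Disk) : Disk :=
  radial (Classical.choose (exists_radial_eq z)) (15 * (1 - ‖(z : ℂ)‖))

theorem tent_subset_tent_enlarge {z b : Disk} (h : (Tent z ∩ Tent b).Nonempty)
    (hzb : 1 - ‖(z : ℂ)‖ ≤ 2 * (1 - ‖(b : ℂ)‖)) : Tent z ⊆ Tent (enlarge b) := by
  obtain ⟨η, hη⟩ := exists_radial_eq z
  have hz : 0 < 1 - ‖(z : ℂ)‖ := by linarith [norm_disk_lt z]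
  have hb : 0 < 1 - ‖(b : ℂ)‖ := by linarith [norm_disk_lt b]
  have hb' := Classical.choose_spec (exists_radial_eq b)
  have := tent_subset_of_inter_nonempty (η := η)
    (ζ := Classical.choose (exists_radial_eq b)) hz hb (by rwa [hη, hb']) hzb
  rwa [hη] at this

theorem Doubling.tent_enlarge_le {W : Measure Torus} {D : ℝ≥0} (h : Doubling W D) (z : Disk) :
    W (Tent (enlarge z)) ≤ D * W (Tent z) := by
  have hz : 0 < 1 - ‖(z : ℂ)‖ := by linarith [norm_disk_lt z]
  have hz' := Classical.choose_spec (exists_radial_eq z)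
  refine (measure_mono (tent_subset_ball _ (by positivity))).trans
    ((h.ball_le hz (by linarith)).trans ?_)
  gcongr
  exact (ball_subset_tent _ hz).trans (by rw [hz'])

/-- Vitali covering: every family of tents contains a countable disjoint subfamily whose
enlargements cover. -/
theorem exists_disjoint_tents (Z : Set Disk) : ∃ u ⊆ Z, u.Countable ∧ u.PairwiseDisjoint Tent ∧
    ∀ z ∈ Z, ∃ b ∈ u, Tent z ⊆ Tent (enlarge b) := by
  obtain ⟨u, hu, hd, hc⟩ := Vitali.exists_disjoint_subfamily_covering_enlargement Tent Z
    (fun z => 1 - ‖(z : ℂ)‖) 2 one_lt_two (fun z _ => by linarith [norm_disk_lt z]) 1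
    (fun z _ => by linarith [norm_nonneg (z : ℂ)]) (fun z _ => tent_nonempty z)
  refine ⟨u, hu, ?_, hd, fun z hz => ?_⟩
  · exact hd.countable_of_isOpen (fun z _ => isOpen_tent z) (fun z _ => tent_nonempty z)
  · obtain ⟨b, hb, h1, h2⟩ := hc z hz
    exact ⟨b, hb, tent_subset_tent_enlarge h1 h2⟩

theorem tsum_rpow_le {ι : Type*} (a : ι → ℝ≥0∞) {t : ℝ} (ht : 1 ≤ t) :
    ∑' i, a i ^ t ≤ (∑' i, a i) ^ t := by
  have h : ∀ x : ℝ≥0∞, x ^ t = x * x ^ (t - 1) := fun x => by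
    conv_rhs => rw [← ENNReal.rpow_one x, ← ENNReal.rpow_mul, one_mul]
    rw [← ENNReal.rpow_add_of_nonneg _ _ zero_le_one (by linarith)]
    congr 1; ring
  rw [h (∑' i, a i), ← ENNReal.tsum_mul_right]
  refine ENNReal.tsum_le_tsum fun i => ?_
  rw [h]
  have : 0 ≤ t - 1 := by linarith
  gcongr
  exact ENNReal.le_tsum i

/-- A Carleson condition over tents passes to boxes over arbitrary sets. -/
theorem measure_box_le {W : Measure Torus} {D : ℝ≥0} (hD : Doubling W D) {τ : Measure Disk}
    {K : ℝ≥0∞} {t : ℝ} (ht : 1 ≤ t) (hτ : ∀ w, τ (box (Tent w)) ≤ K * W (Tent w) ^ t)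
    (U : Set Torus) : τ (box U) ≤ K * (D : ℝ≥0∞) ^ t * W U ^ t := by
  have ht0 : 0 ≤ t := by linarith
  obtain ⟨u, hu, hc, hd, hcov⟩ := exists_disjoint_tents (box U)
  have : Countable u := hc.to_subtype
  calc τ (box U) ≤ τ (⋃ b : u, box (Tent (enlarge b))) := by
        refine measure_mono fun z hz => ?_
        obtain ⟨b, hb, h⟩ := hcov z hz
        exact mem_iUnion.2 ⟨⟨b, hb⟩, h⟩
    _ ≤ ∑' b : u, τ (box (Tent (enlarge b))) := measure_iUnion_le _
    _ ≤ ∑' b : u, K * (D : ℝ≥0∞) ^ t * W (Tent b) ^ t := by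
        refine ENNReal.tsum_le_tsum fun b => (hτ _).trans ?_
        rw [mul_assoc, ← ENNReal.mul_rpow_of_nonneg _ _ ht0]
        gcongr
        exact hD.tent_enlarge_le _
    _ ≤ K * (D : ℝ≥0∞) ^ t * (∑' b : u, W (Tent b)) ^ t := by
        rw [ENNReal.tsum_mul_left]
        gcongr
        exact tsum_rpow_le _ ht
    _ ≤ _ := by
        gcongr
        rw [← measure_biUnion hc hd fun z _ => measurableSet_tent z]
        exact measure_mono (iUnion₂_subset fun z hz => hu hz)

/-! ### Nontangential maximal functions -/

/-- The nontangential maximal function of a function on the disk. -/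
def ntSup (F : Disk → ℝ≥0∞) (ξ : Torus) : ℝ≥0∞ := ⨆ z, ⨆ _ : ξ ∈ Tent z, F z

theorem le_ntSup (F : Disk → ℝ≥0∞) {ξ : Torus} {z : Disk} (h : ξ ∈ Tent z) : F z ≤ ntSup F ξ :=
  le_iSup₂ (f := fun z (_ : ξ ∈ Tent z) => F z) z h

theorem setOf_lt_ntSup (F : Disk → ℝ≥0∞) (l : ℝ≥0∞) :
    {ξ | l < ntSup F ξ} = ⋃ z ∈ {z | l < F z}, Tent z := by
  ext ξ
  simp only [ntSup, mem_ofPred_eq, lt_iSup_iff, mem_iUnion, exists_prop]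
  exact exists_congr fun z => and_comm

theorem measurable_ntSup (F : Disk → ℝ≥0∞) : Measurable (ntSup F) := by
  refine measurable_of_Ioi fun l => ?_
  change MeasurableSet {ξ | l < ntSup F ξ}
  rw [setOf_lt_ntSup]
  exact (isOpen_biUnion fun z _ => isOpen_tent z).measurableSet

/-- The `W`-average of `h` over the tent of `z`. -/
def tentAvg (W : Measure Torus) (h : Torus → ℝ≥0∞) (z : Disk) : ℝ≥0∞ :=
  (∫⁻ ξ in Tent z, h ξ ∂W) / W (Tent z)

theorem measurable_tentAvg (W : Measure Torus) (h : Torus → ℝ≥0∞) : Measurable (tentAvg W h) := by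
  have : tentAvg W h = fun z => (W.withDensity h) (Tent z) / W (Tent z) := by
    ext z; rw [tentAvg, withDensity_apply _ (measurableSet_tent z)]
  rw [this]
  exact (measurable_measure_tent _).div (measurable_measure_tent _)

theorem mul_measure_ntSup_tentAvg_le {W : Measure Torus} {D : ℝ≥0} (hD : Doubling W D)
    (h : Torus → ℝ≥0∞) (l : ℝ≥0∞) :
    l * W {ξ | l < ntSup (tentAvg W h) ξ} ≤ D * ∫⁻ ξ, h ξ ∂W := by
  rw [setOf_lt_ntSup]
  obtain ⟨u, hu, hc, hd, hcov⟩ := exists_disjoint_tents {z | l < tentAvg W h z}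
  have : Countable u := hc.to_subtype
  calc _ ≤ l * W (⋃ b : u, Tent (enlarge b)) := by
        gcongr
        refine iUnion₂_subset fun z hz => ?_
        obtain ⟨b, hb, h⟩ := hcov z hz
        exact h.trans (subset_iUnion (fun b : u => Tent (enlarge b)) ⟨b, hb⟩)
    _ ≤ l * ∑' b : u, W (Tent (enlarge b)) := by gcongr; exact measure_iUnion_le _
    _ = ∑' b : u, l * W (Tent (enlarge b)) := ENNReal.tsum_mul_left.symm
    _ ≤ ∑' b : u, D * ∫⁻ ξ in Tent b, h ξ ∂W := by
        refine ENNReal.tsum_le_tsum fun b => ?_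
        calc _ ≤ l * (D * W (Tent b)) := by gcongr; exact hD.tent_enlarge_le _
          _ = D * (l * W (Tent b)) := by ring
          _ ≤ _ := by
            gcongr
            exact ENNReal.mul_le_of_le_div (le_of_lt (hu b.2))
    _ = D * ∫⁻ ξ in ⋃ b ∈ u, Tent b, h ξ ∂W := by
        rw [ENNReal.tsum_mul_left, lintegral_biUnion hc (fun z _ => measurableSet_tent z) hd]
    _ ≤ _ := by gcongr; exact Measure.restrict_le_self

/-! ### Layer cake -/

theorem lintegral_Ioi_rpow_indicator {r : ℝ} (hr : 0 < r) (x : ℝ≥0∞) :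
    ∫⁻ l in Ioi (0 : ℝ), {l : ℝ | ENNReal.ofReal l < x}.indicator
      (fun l => ENNReal.ofReal (r * l ^ (r - 1))) l = x ^ r := by
  have hfin : ∀ y : ℝ≥0, ∫⁻ l in Ioi (0 : ℝ), {l : ℝ | ENNReal.ofReal l < y}.indicator
      (fun l => ENNReal.ofReal (r * l ^ (r - 1))) l = (y : ℝ≥0∞) ^ r := by
    intro y
    have h := lintegral_rpow_eq_lintegral_meas_lt_mul (α := Unit) (Measure.dirac ())
      (f := fun _ => (y : ℝ)) (ae_of_all _ fun _ => y.2) aemeasurable_const hr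
    rw [lintegral_dirac, ← ENNReal.ofReal_rpow_of_nonneg y.coe_nonneg hr.le,
      ENNReal.ofReal_coe_nnreal, ← lintegral_const_mul' _ _ ENNReal.ofReal_ne_top] at h
    rw [h]
    refine setLIntegral_congr_fun measurableSet_Ioi fun l hl => ?_
    have hl' : (0 : ℝ) < l := hl
    by_cases hly : l < y
    · rw [indicator_of_mem]
      · simp only [hly, ofPred_true, measure_univ, one_mul]
        rw [ENNReal.ofReal_mul hr.le]
      · change ENNReal.ofReal l < y
        rw [← ENNReal.ofReal_coe_nnreal]
        exact (ENNReal.ofReal_lt_ofReal_iff (hl'.trans hly)).2 hly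
    · rw [indicator_of_notMem]
      · simp [hly]
      · intro h'
        change ENNReal.ofReal l < y at h'
        rw [← ENNReal.ofReal_coe_nnreal] at h'
        exact hly (lt_of_not_ge fun h'' => h'.not_ge (ENNReal.ofReal_le_ofReal h''))
  induction x using ENNReal.recTopCoe with
  | coe y => exact hfin y
  | top =>
    rw [ENNReal.top_rpow_of_pos hr]
    refine ENNReal.eq_top_of_forall_nnreal_le fun y => ?_
    have h := hfin (y ^ (1 / r))
    rw [ENNReal.coe_rpow_of_nonneg _ (by positivity), ← ENNReal.rpow_mul, one_div,
      inv_mul_cancel₀ hr.ne', ENNReal.rpow_one] at h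
    rw [← h]
    refine lintegral_mono fun l => ?_
    refine indicator_le_indicator_of_subset (fun l _ => ENNReal.ofReal_lt_top) (fun _ => zero_le) _

theorem measurableSet_ofReal_lt {α : Type*} [MeasurableSpace α] {F : α → ℝ≥0∞} (hF : Measurable F) :
    MeasurableSet {x : α × ℝ | ENNReal.ofReal x.2 < F x.1} :=
  measurableSet_lt (ENNReal.measurable_ofReal.comp measurable_snd) (hF.comp measurable_fst)

/-- Tonelli for a function on the region under the graph of `F`. -/
theorem lintegral_mul_lintegral_indicator {α : Type*} [MeasurableSpace α] (V : Measure α)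
    [SFinite V] {F k : α → ℝ≥0∞} (hF : Measurable F) (hk : Measurable k) {φ : ℝ → ℝ≥0∞}
    (hφ : Measurable φ) :
    ∫⁻ l in Ioi (0 : ℝ), φ l * ∫⁻ x in {x | ENNReal.ofReal l < F x}, k x ∂V =
      ∫⁻ x, k x * (∫⁻ l in Ioi (0 : ℝ), {l : ℝ | ENNReal.ofReal l < F x}.indicator φ l) ∂V := by
  have hS := measurableSet_ofReal_lt hF
  have hm : Measurable (fun y : α × ℝ =>
      {x : α × ℝ | ENNReal.ofReal x.2 < F x.1}.indicator (fun x => k x.1 * φ x.2) y) :=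
    ((hk.comp measurable_fst).mul (hφ.comp measurable_snd)).indicator hS
  have h1 : ∀ l, φ l * ∫⁻ x in {x | ENNReal.ofReal l < F x}, k x ∂V =
      ∫⁻ x, {x : α × ℝ | ENNReal.ofReal x.2 < F x.1}.indicator (fun x => k x.1 * φ x.2) (x, l) ∂V := by
    intro l
    have hl : MeasurableSet {x | ENNReal.ofReal l < F x} := measurableSet_lt measurable_const hF
    rw [← lintegral_indicator hl, ← lintegral_const_mul _ (hk.indicator hl)]
    refine lintegral_congr fun x => ?_
    by_cases h : ENNReal.ofReal l < F x
    · rw [indicator_of_mem (by exact h), indicator_of_mem (by exact h), mul_comm]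
    · rw [indicator_of_notMem (by exact h), indicator_of_notMem (by exact h), mul_zero]
  have h2 : ∀ x, k x * (∫⁻ l in Ioi (0 : ℝ), {l : ℝ | ENNReal.ofReal l < F x}.indicator φ l) =
      ∫⁻ l in Ioi (0 : ℝ),
        {x : α × ℝ | ENNReal.ofReal x.2 < F x.1}.indicator (fun x => k x.1 * φ x.2) (x, l) := by
    intro x
    have hl : MeasurableSet {l : ℝ | ENNReal.ofReal l < F x} :=
      measurableSet_lt ENNReal.measurable_ofReal measurable_const
    rw [← lintegral_const_mul _ (hφ.indicator hl)]
    refine lintegral_congr fun l => ?_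
    by_cases h : ENNReal.ofReal l < F x
    · rw [indicator_of_mem (by exact h), indicator_of_mem (by exact h)]
    · rw [indicator_of_notMem (by exact h), indicator_of_notMem (by exact h), mul_zero]
  simp_rw [h1, h2]
  exact (lintegral_lintegral_swap hm.aemeasurable).symm

theorem lintegral_rpow_layer {α : Type*} [MeasurableSpace α] (V : Measure α) [SFinite V]
    {F : α → ℝ≥0∞} (hF : Measurable F) {r : ℝ} (hr : 0 < r) :
    ∫⁻ x, F x ^ r ∂V =
      ∫⁻ l in Ioi (0 : ℝ), ENNReal.ofReal (r * l ^ (r - 1)) * V {x | ENNReal.ofReal l < F x} := by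
  have h := lintegral_mul_lintegral_indicator V hF (k := fun _ => 1) measurable_const
    (φ := fun l => ENNReal.ofReal (r * l ^ (r - 1))) (by fun_prop)
  simp only [setLIntegral_one, one_mul, lintegral_Ioi_rpow_indicator hr] at h
  exact h.symm

/-! ### The maximal theorem and the Carleson embedding -/

/-- The maximal theorem for averages over tents. -/
theorem exists_lintegral_ntSup_tentAvg_le {W : Measure Torus} [IsFiniteMeasure W] {D : ℝ≥0}
    (hD : Doubling W D) {r : ℝ} (hr : 1 < r) :
    ∃ C : ℝ≥0, ∀ h : Torus → ℝ≥0∞, Measurable h →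
      ∫⁻ ξ, ntSup (tentAvg W h) ξ ^ r ∂W ≤ C * ∫⁻ ξ, h ξ ^ r ∂W := by
  have hr1 : 0 < r - 1 := by linarith
  refine ⟨D * (2 * (r / (r - 1)) * 2 ^ (r - 1)).toNNReal, fun h hh => ?_⟩
  have hlevel : ∀ l : ℝ, 0 < l →
      ENNReal.ofReal (l / 2) * W {ξ | ENNReal.ofReal l < ntSup (tentAvg W h) ξ} ≤
        D * ∫⁻ ξ in {ξ | ENNReal.ofReal l < 2 * h ξ}, h ξ ∂W := by
    intro l hl
    have hS : MeasurableSet {ξ | ENNReal.ofReal l < 2 * h ξ} :=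
      measurableSet_lt measurable_const (hh.const_mul 2)
    rw [← lintegral_indicator hS]
    refine le_trans ?_ (mul_measure_ntSup_tentAvg_le hD _ (ENNReal.ofReal (l / 2)))
    refine mul_le_mul' le_rfl (measure_mono ?_)
    rw [setOf_lt_ntSup, setOf_lt_ntSup]
    refine biUnion_subset_biUnion_left fun z hz => ?_
    rw [mem_ofPred_eq] at hz ⊢
    have e : ENNReal.ofReal l = ENNReal.ofReal (l / 2) + ENNReal.ofReal (l / 2) := by
      rw [← ENNReal.ofReal_add (by positivity) (by positivity), add_halves]
    have h1 : tentAvg W h z ≤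
        tentAvg W ({ξ | ENNReal.ofReal l < 2 * h ξ}.indicator h) z + ENNReal.ofReal (l / 2) := by
      have h2 : ∫⁻ ξ in Tent z, h ξ ∂W ≤
          (∫⁻ ξ in Tent z, {ξ | ENNReal.ofReal l < 2 * h ξ}.indicator h ξ ∂W) +
            ENNReal.ofReal (l / 2) * W (Tent z) := by
        rw [← setLIntegral_const, ← lintegral_add_right _ measurable_const]
        refine lintegral_mono fun ξ => ?_
        by_cases hξ : ENNReal.ofReal l < 2 * h ξ
        · rw [indicator_of_mem (by exact hξ)]; exact le_self_add
        · rw [indicator_of_notMem (by exact hξ), zero_add]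
          have h3 : 2 * h ξ ≤ 2 * ENNReal.ofReal (l / 2) := by
            rw [two_mul (ENNReal.ofReal _), ← e]; exact not_lt.1 hξ
          exact (ENNReal.mul_le_mul_iff_right (by simp) (by simp)).1 h3
      refine (ENNReal.div_le_div_right h2 _).trans ?_
      rw [ENNReal.add_div]
      exact add_le_add le_rfl (ENNReal.div_le_of_le_mul le_rfl)
    rw [e] at hz
    exact (ENNReal.add_lt_add_iff_right ENNReal.ofReal_ne_top).1 (hz.trans_le h1)
  rw [lintegral_rpow_layer W (measurable_ntSup _) (by linarith)]
  calc _ ≤ ∫⁻ l in Ioi (0 : ℝ), ENNReal.ofReal (2 * (r / (r - 1))) * D *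
        (ENNReal.ofReal ((r - 1) * l ^ (r - 1 - 1)) *
          ∫⁻ ξ in {ξ | ENNReal.ofReal l < 2 * h ξ}, h ξ ∂W) := by
        refine setLIntegral_mono' measurableSet_Ioi fun l hl => ?_
        have hl' : (0 : ℝ) < l := hl
        have e : ENNReal.ofReal (r * l ^ (r - 1)) = ENNReal.ofReal (2 * (r / (r - 1))) *
            ENNReal.ofReal ((r - 1) * l ^ (r - 1 - 1)) * ENNReal.ofReal (l / 2) := by
          rw [← ENNReal.ofReal_mul (by positivity), ← ENNReal.ofReal_mul (by positivity)]
          congr 1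
          rw [Real.rpow_sub_one hl'.ne' (r - 1)]
          field_simp
        rw [e, mul_assoc]
        calc _ ≤ ENNReal.ofReal (2 * (r / (r - 1))) *
            ENNReal.ofReal ((r - 1) * l ^ (r - 1 - 1)) *
              (D * ∫⁻ ξ in {ξ | ENNReal.ofReal l < 2 * h ξ}, h ξ ∂W) := by
              exact mul_le_mul' le_rfl (hlevel l hl')
          _ = _ := by ring
    _ = ENNReal.ofReal (2 * (r / (r - 1))) * D * ∫⁻ ξ, h ξ * (2 * h ξ) ^ (r - 1) ∂W := by
        rw [lintegral_const_mul' _ _ (by finiteness),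
          lintegral_mul_lintegral_indicator W (hh.const_mul 2) hh (by fun_prop)]
        simp_rw [lintegral_Ioi_rpow_indicator hr1]
    _ = _ := by
        have e : ∀ ξ, h ξ * (2 * h ξ) ^ (r - 1) = 2 ^ (r - 1) * h ξ ^ r := fun ξ => by
          rw [ENNReal.mul_rpow_of_nonneg _ _ hr1.le]
          have : h ξ ^ r = h ξ * h ξ ^ (r - 1) := by
            nth_rw 2 [← ENNReal.rpow_one (h ξ)]
            rw [← ENNReal.rpow_add_of_nonneg _ _ zero_le_one hr1.le]
            congr 1; ring
          rw [this]; ring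
        simp_rw [e]
        rw [lintegral_const_mul' _ _ (ENNReal.rpow_ne_top_of_nonneg hr1.le (by simp))]
        have e2 : (2 : ℝ≥0∞) ^ (r - 1) = ENNReal.ofReal (2 ^ (r - 1)) := by
          rw [← ENNReal.ofReal_rpow_of_pos two_pos, ENNReal.ofReal_ofNat]
        rw [e2, ENNReal.coe_mul, ← ENNReal.ofReal, ENNReal.ofReal_mul (q := 2 ^ (r - 1))
          (by positivity)]
        ring

/-- The Carleson embedding: a measure satisfying a Carleson condition of order `t` integrates
`F ^ t` as if it lived on the circle. -/
theorem lintegral_rpow_le_of_carleson {W : Measure Torus} [IsFiniteMeasure W] {D : ℝ≥0}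
    (hD : Doubling W D) {τ : Measure Disk} [SFinite τ] {K : ℝ≥0∞} {t : ℝ} (ht : 1 ≤ t)
    (hτ : ∀ w, τ (box (Tent w)) ≤ K * W (Tent w) ^ t) {F : Disk → ℝ≥0∞} (hF : Measurable F) :
    ∫⁻ z, F z ^ t ∂τ ≤ K * (D : ℝ≥0∞) ^ t * ENNReal.ofReal t * (∫⁻ ξ, ntSup F ξ ∂W) ^ t := by
  have ht0 : 0 < t := by linarith
  have ht1 : 0 ≤ t - 1 := by linarith
  set A := ∫⁻ ξ, ntSup F ξ ∂W
  have hsplit : ∀ x : ℝ≥0∞, x ^ t = x ^ (t - 1) * x := fun x => by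
    conv_rhs => rw [← ENNReal.rpow_one x, ← ENNReal.rpow_mul, one_mul]
    rw [← ENNReal.rpow_add_of_nonneg _ _ ht1 zero_le_one]
    congr 1; ring
  rw [lintegral_rpow_layer τ hF ht0]
  calc _ ≤ ∫⁻ l in Ioi (0 : ℝ), K * (D : ℝ≥0∞) ^ t * ENNReal.ofReal t * A ^ (t - 1) *
        W {ξ | ENNReal.ofReal l < ntSup F ξ} := by
        refine setLIntegral_mono' measurableSet_Ioi fun l hl => ?_
        have hl' : (0 : ℝ) < l := hl
        set w := W {ξ | ENNReal.ofReal l < ntSup F ξ}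
        have h1 : τ {z | ENNReal.ofReal l < F z} ≤ K * (D : ℝ≥0∞) ^ t * w ^ t := by
          refine (measure_mono fun z hz => ?_).trans
            (measure_box_le hD ht hτ {ξ | ENNReal.ofReal l < ntSup F ξ})
          exact fun ξ hξ => lt_of_lt_of_le hz (le_ntSup F hξ)
        have h2 : ENNReal.ofReal l * w ≤ A := by
          refine le_trans ?_ (mul_meas_ge_le_lintegral (measurable_ntSup F) (ENNReal.ofReal l))
          refine mul_le_mul' le_rfl (measure_mono fun ξ hξ => ?_)
          exact le_of_lt (α := ℝ≥0∞) hξ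
        calc _ ≤ ENNReal.ofReal (t * l ^ (t - 1)) * (K * (D : ℝ≥0∞) ^ t * w ^ t) := by gcongr
          _ = K * (D : ℝ≥0∞) ^ t * ENNReal.ofReal t * (ENNReal.ofReal l * w) ^ (t - 1) * w := by
            rw [ENNReal.ofReal_mul ht0.le, ← ENNReal.ofReal_rpow_of_pos hl', hsplit w,
              ENNReal.mul_rpow_of_nonneg _ _ ht1]
            ring
          _ ≤ _ := by gcongr
    _ = K * (D : ℝ≥0∞) ^ t * ENNReal.ofReal t * A ^ (t - 1) *
        ∫⁻ l in Ioi (0 : ℝ), W {ξ | ENNReal.ofReal l < ntSup F ξ} := by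
        refine lintegral_const_mul _ (Antitone.measurable fun a b hab =>
          measure_mono fun ξ hξ => ?_)
        exact lt_of_le_of_lt (ENNReal.ofReal_le_ofReal hab) hξ
    _ = _ := by
        have h := lintegral_rpow_layer W (measurable_ntSup F) one_pos
        simp only [ENNReal.rpow_one, sub_self, Real.rpow_zero, mul_one, ENNReal.ofReal_one,
          one_mul] at h
        rw [← h, hsplit A]
        ring

/-! ### Poisson majorants of powers of analytic functions -/

theorem one_le_norm_canonicalFactor {w z : ℂ} (hw : ‖w‖ < 1) (hz : ‖z‖ < 1) (hzw : z ≠ w) :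
    1 ≤ ‖Complex.canonicalFactor 1 w z‖ := by
  rw [Complex.canonicalFactor_apply, norm_div, one_le_div (by simpa [sub_eq_zero] using hzw)]
  refine le_of_sq_le_sq ?_ (norm_nonneg _)
  rw [← Complex.normSq_eq_norm_sq, ← Complex.normSq_eq_norm_sq, ← sub_nonneg]
  have h : Complex.normSq (((1 : ℝ) : ℂ) ^ 2 - (starRingEnd ℂ) w * z)
      - Complex.normSq (((1 : ℝ) : ℂ) * (z - w))
      = (1 - Complex.normSq w) * (1 - Complex.normSq z) := by
    simp only [Complex.normSq_apply, Complex.ofReal_one, one_pow, one_mul, Complex.sub_re,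
      Complex.sub_im, Complex.mul_re, Complex.mul_im, Complex.conj_re, Complex.conj_im,
      Complex.one_re, Complex.one_im]
    ring
  rw [h, Complex.normSq_eq_norm_sq, Complex.normSq_eq_norm_sq]
  have h1 : ‖w‖ ^ 2 < 1 := by nlinarith [norm_nonneg w]
  have h2 : ‖z‖ ^ 2 < 1 := by nlinarith [norm_nonneg z]
  nlinarith

/-- Dividing out the Blaschke factors: an analytic function without zeros on the circle has a
zero-free majorant with the same modulus on the circle off a discrete set. -/
theorem exists_zero_free_majorant {F : ℂ → ℂ} (hF : AnalyticOnNhd ℂ F (Metric.closedBall 0 1))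
    (h0 : ∀ ζ ∈ Metric.sphere (0 : ℂ) 1, F ζ ≠ 0) :
    ∃ g : ℂ → ℂ, AnalyticOnNhd ℂ g (Metric.closedBall 0 1) ∧
      (∀ z ∈ Metric.closedBall (0 : ℂ) 1, g z ≠ 0) ∧
      (∀ z ∈ Metric.ball (0 : ℂ) 1, ‖F z‖ ≤ ‖g z‖) ∧
      (fun ζ => ‖F ζ‖) =ᶠ[codiscreteWithin (Metric.sphere 0 1)] fun ζ => ‖g ζ‖ := by
  have hord : ∀ v ∈ Metric.sphere (0 : ℂ) 1, meromorphicOrderAt F v = 0 := fun v hv => by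
    have hv' := hF v (Metric.sphere_subset_closedBall hv)
    exact (hv'.meromorphicNFAt.meromorphicOrderAt_eq_zero_iff).2 (h0 v hv)
  have htop : ∀ u : Metric.closedBall (0 : ℂ) 1, meromorphicOrderAt F u ≠ ⊤ := fun u => by
    have h1 : (1 : ℂ) ∈ Metric.sphere (0 : ℂ) 1 := by simp
    refine hF.meromorphicOn.meromorphicOrderAt_ne_top_of_isPreconnected
      (convex_closedBall (0 : ℂ) 1).isPreconnected
      (Metric.sphere_subset_closedBall h1) u.2 ?_
    rw [hord 1 h1]; simp
  obtain ⟨g, hg⟩ := hF.meromorphicOn.exists_ecanonicalDecomp htop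
  set D := MeromorphicOn.divisor F (Metric.ball 0 1)
  have hD : 0 ≤ D :=
    MeromorphicOn.AnalyticOnNhd.divisor_nonneg (hF.mono Metric.ball_subset_closedBall)
  have hDout : ∀ u, u ∉ Metric.ball (0 : ℂ) 1 → D u = 0 := fun u hu =>
    Function.locallyFinsuppWithin.apply_eq_zero_of_notMem D hu
  have hsph : ∏ᶠ v, (fun x : ℂ => x - v) ^ (MeromorphicOn.divisor F (Metric.sphere 0 1)) v = 1 := by
    refine finprod_eq_one_of_forall_eq_one fun v => ?_
    by_cases hv : v ∈ Metric.sphere (0 : ℂ) 1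
    · rw [MeromorphicOn.divisor_apply (hF.meromorphicOn.mono_set Metric.sphere_subset_closedBall) hv,
        hord v hv]
      simp
    · rw [Function.locallyFinsuppWithin.apply_eq_zero_of_notMem _ hv, zpow_zero]
  have heq := hg.eventuallyEq
  rw [hsph, mul_one] at heq
  set B := ∏ᶠ u, Complex.canonicalFactor 1 u ^ (-D u)
  have hB1 : ∀ z ∈ Metric.ball (0 : ℂ) 1, ‖B z‖ ≤ 1 := by
    intro z hz
    refine finprod_induction (fun φ : ℂ → ℂ => ‖φ z‖ ≤ 1) (by simp) (fun x y hx hy => ?_)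
      fun u => ?_
    · rw [Pi.mul_apply, norm_mul]; exact mul_le_one₀ hx (norm_nonneg _) hy
    · rw [Pi.pow_apply, norm_zpow]
      by_cases hu : u ∈ Metric.ball (0 : ℂ) 1
      · by_cases hzu : z = u
        · rw [hzu, Complex.canonicalFactor_apply_self, norm_zero]
          rw [zero_zpow_eq]; split_ifs <;> norm_num
        · exact zpow_le_one_of_nonpos₀ (one_le_norm_canonicalFactor (mem_ball_zero_iff.1 hu)
            (mem_ball_zero_iff.1 hz) hzu) (neg_nonpos.2 (hD u))
      · rw [hDout u hu]; simp
  have hB2 : ∀ z ∈ Metric.sphere (0 : ℂ) 1, ‖B z‖ = 1 := by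
    intro z hz
    refine finprod_induction (fun φ : ℂ → ℂ => ‖φ z‖ = 1) (by simp) (fun x y hx hy => ?_)
      fun u => ?_
    · rw [Pi.mul_apply, norm_mul, hx, hy, one_mul]
    · rw [Pi.pow_apply, norm_zpow]
      by_cases hu : u ∈ Metric.ball (0 : ℂ) 1
      · rw [Complex.norm_canonicalFactor_eval_circle_eq_one hu hz, one_zpow]
      · rw [hDout u hu]; simp
  refine ⟨g, hg.analyticOnNhd, hg.ne_zero, fun z hz => ?_, ?_⟩
  · have hzc := Metric.ball_subset_closedBall hz
    have h1 := mem_codiscreteWithin_iff_forall_mem_nhdsNE.1 heq z hzc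
    have h2 : ∀ᶠ w in 𝓝[≠] z, ‖F w‖ ≤ ‖g w‖ := by
      filter_upwards [h1, mem_nhdsWithin_of_mem_nhds (Metric.isOpen_ball.mem_nhds hz)] with w hw hwb
      rcases hw with hw | hw
      · have hw' : F w = (B • g) w := hw
        rw [hw', Pi.smul_apply', smul_eq_mul, norm_mul]
        exact mul_le_of_le_one_left (norm_nonneg _) (hB1 w hwb)
      · exact absurd (Metric.ball_subset_closedBall hwb) hw
    exact le_of_tendsto_of_tendsto
      ((hF z hzc).continuousAt.norm.tendsto.mono_left nhdsWithin_le_nhds)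
      ((hg.analyticOnNhd z hzc).continuousAt.norm.tendsto.mono_left nhdsWithin_le_nhds) h2
  · have h1 := heq.filter_mono (codiscreteWithin_mono Metric.sphere_subset_closedBall)
    filter_upwards [h1, self_mem_codiscreteWithin (Metric.sphere (0 : ℂ) 1)] with ζ h hζ
    rw [h, Pi.smul_apply', smul_eq_mul, norm_mul, hB2 ζ hζ, one_mul]

theorem continuousOn_poissonKernel {z : ℂ} (hz : ‖z‖ < 1) :
    ContinuousOn (poissonKernel 0 z) (Metric.sphere 0 1) := by
  unfold poissonKernel
  refine ContinuousOn.div (by fun_prop) (by fun_prop) fun ζ hζ => ?_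
  have : ζ ≠ z := fun h => by
    rw [h] at hζ; rw [mem_sphere_zero_iff_norm] at hζ; linarith
  simpa [sub_eq_zero] using this

theorem poissonKernel_nonneg {z ζ : ℂ} (hz : ‖z‖ < 1) (hζ : ζ ∈ Metric.sphere (0 : ℂ) 1) :
    0 ≤ poissonKernel 0 z ζ := by
  rw [mem_sphere_zero_iff_norm] at hζ
  rw [poissonKernel_def, sub_zero, sub_zero, hζ]
  have : ‖z‖ ^ 2 ≤ 1 := by nlinarith [norm_nonneg z]
  exact div_nonneg (by linarith) (by positivity)

theorem circleAverage_poissonKernel {z : ℂ} (hz : ‖z‖ < 1) :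
    Real.circleAverage (poissonKernel 0 z) 0 1 = 1 := by
  have h := DiffContOnCl.circleAverage_poissonKernel_smul (E := ℂ) (f := fun _ => (1 : ℂ))
    (c := 0) (R := 1) (w := z) diffContOnCl_const (by simpa using hz)
  have h2 := Complex.reCLM.circleAverage_comp_comm
    (f := poissonKernel 0 z • fun _ => (1 : ℂ)) (c := 0) (R := 1) ?_
  · rw [h] at h2
    convert h2 using 2
    · ext ζ; simp
    · simp
  · refine ContinuousOn.circleIntegrable zero_le_one ?_
    exact (continuousOn_poissonKernel hz).smul continuousOn_const

/-- Powers of the modulus of an analytic function are dominated by their Poisson integral. -/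
theorem norm_rpow_le_circleAverage {F : ℂ → ℂ} (hF : AnalyticOnNhd ℂ F (Metric.closedBall 0 1))
    (h0 : ∀ ζ ∈ Metric.sphere (0 : ℂ) 1, F ζ ≠ 0) {z : ℂ} (hz : ‖z‖ < 1) {s : ℝ} (hs : 0 < s) :
    ‖F z‖ ^ s ≤ Real.circleAverage (fun ζ => poissonKernel 0 z ζ * ‖F ζ‖ ^ s) 0 1 := by
  obtain ⟨g, hg, hg0, hFg, hsph⟩ := exists_zero_free_majorant hF h0
  have hzb : z ∈ Metric.ball (0 : ℂ) 1 := by simpa using hz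
  have hcP := continuousOn_poissonKernel hz
  have hcg : ContinuousOn g (Metric.sphere 0 1) :=
    (hg.mono Metric.sphere_subset_closedBall).continuousOn
  have hg0' : ∀ ζ ∈ Metric.sphere (0 : ℂ) 1, ‖g ζ‖ ≠ 0 := fun ζ hζ =>
    norm_ne_zero_iff.2 (hg0 ζ (Metric.sphere_subset_closedBall hζ))
  have hclog : ContinuousOn (fun ζ => Real.log ‖g ζ‖) (Metric.sphere 0 1) := hcg.norm.log hg0'
  have hharm : Real.circleAverage (poissonKernel 0 z • fun ζ => Real.log ‖g ζ‖) 0 1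
      = Real.log ‖g z‖ :=
    InnerProductSpace.HarmonicOnNhd.circleAverage_poissonKernel_smul
      (fun w hw => (hg w hw).harmonicAt_log_norm (hg0 w hw)) hzb
  have hgz : 0 < ‖g z‖ := norm_pos_iff.2 (hg0 z (Metric.ball_subset_closedBall hzb))
  have e1 : Real.circleAverage (fun ζ => poissonKernel 0 z ζ * ‖F ζ‖ ^ s) 0 1 =
      Real.circleAverage (fun ζ => poissonKernel 0 z ζ * ‖g ζ‖ ^ s) 0 1 := by
    refine Real.circleAverage_congr_codiscreteWithin ?_ one_ne_zero
    rw [abs_one]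
    filter_upwards [hsph] with ζ h
    rw [h]
  set c := ‖g z‖ ^ s
  have hint1 : CircleIntegrable ((c * (1 - s * Real.log ‖g z‖)) • poissonKernel 0 z) 0 1 :=
    ContinuousOn.circleIntegrable zero_le_one (hcP.const_smul _)
  have hint2 : CircleIntegrable
      ((c * s) • (poissonKernel 0 z • fun ζ => Real.log ‖g ζ‖)) 0 1 :=
    ContinuousOn.circleIntegrable zero_le_one ((hcP.smul hclog).const_smul _)
  have e2 := Real.circleAverage_add hint1 hint2
  rw [Real.circleAverage_smul, Real.circleAverage_smul, hharm, circleAverage_poissonKernel hz] at e2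
  rw [smul_eq_mul, smul_eq_mul] at e2
  calc ‖F z‖ ^ s ≤ c := Real.rpow_le_rpow (norm_nonneg _) (hFg z hzb) hs.le
    _ = c * (1 - s * Real.log ‖g z‖) * 1 + c * s * Real.log ‖g z‖ := by ring
    _ = _ := e2.symm
    _ ≤ Real.circleAverage (fun ζ => poissonKernel 0 z ζ * ‖g ζ‖ ^ s) 0 1 := by
        refine Real.circleAverage_mono (hint1.add hint2) ?_ fun ζ hζ => ?_
        · exact ContinuousOn.circleIntegrable zero_le_one
            (hcP.mul (hcg.norm.rpow_const fun _ _ => Or.inr hs.le))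
        · rw [abs_one] at hζ
          have hgζ : 0 < ‖g ζ‖ := lt_of_le_of_ne (norm_nonneg _) (hg0' ζ hζ).symm
          have hP := poissonKernel_nonneg hz hζ
          -- the tangent line of `exp` at `s * log ‖g z‖` lies below its graph
          have h1 : c * (1 - s * Real.log ‖g z‖) + c * s * Real.log ‖g ζ‖ ≤ ‖g ζ‖ ^ s := by
            have h2 := Real.add_one_le_exp (s * (Real.log ‖g ζ‖ - Real.log ‖g z‖))
            have h3 : ‖g ζ‖ ^ s = c * Real.exp (s * (Real.log ‖g ζ‖ - Real.log ‖g z‖)) := by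
              simp only [c]
              rw [Real.rpow_def_of_pos hgζ, Real.rpow_def_of_pos hgz, ← Real.exp_add]
              congr 1; ring
            rw [h3]
            have hc : 0 ≤ c := by positivity
            nlinarith
          simp only [Pi.add_apply, Pi.smul_apply, Pi.mul_apply, smul_eq_mul]
          nlinarith
    _ = _ := e1.symm

/-- The Poisson kernel as a nonnegative function on the circle. -/
def pk (z : ℂ) (ξ : Torus) : ℝ≥0∞ := ENNReal.ofReal (poissonKernel 0 z ξ)

theorem lintegral_ofReal_arcLength {u : ℂ → ℝ} (hu : ContinuousOn u (Metric.sphere 0 1))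
    (hu0 : ∀ ζ ∈ Metric.sphere (0 : ℂ) 1, 0 ≤ u ζ) :
    ∫⁻ ξ : Torus, ENNReal.ofReal (u ξ) ∂arcLength =
      ENNReal.ofReal (2 * Real.pi) * ENNReal.ofReal (Real.circleAverage u 0 1) := by
  have hc : Continuous fun ξ : Torus => u ξ := continuousOn_iff_continuous_domRestrict.1 hu
  have hc2 : Continuous fun t => u (expPt t) := hc.comp continuous_expPt
  rw [arcLength, lintegral_map (f := fun ξ : Torus => ENNReal.ofReal (u ξ))
    (ENNReal.measurable_ofReal.comp hc.measurable)
    continuous_expPt.measurable, ← ofReal_integral_eq_lintegral_ofReal]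
  · rw [← ENNReal.ofReal_mul (by positivity), Real.circleAverage_eq_integral_add (-Real.pi),
      smul_eq_mul, mul_inv_cancel_left₀ (by positivity),
      intervalIntegral.integral_comp_add_right (fun θ ↦ u (circleMap 0 1 θ)),
      intervalIntegral.integral_of_le (by linarith [Real.pi_pos])]
    congr 2
    · congr 2
      · ring
      · ring
    · ext t; simp [circleMap, expPt]
  · exact (hc2.integrableOn_Icc).mono_set Ioc_subset_Icc_self
  · exact ae_of_all _ fun t => hu0 _ (expPt t).2

theorem enorm_rpow_le_lintegral {F : ℂ → ℂ} (hF : AnalyticOnNhd ℂ F (Metric.closedBall 0 1))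
    (h0 : ∀ ζ ∈ Metric.sphere (0 : ℂ) 1, F ζ ≠ 0) {z : ℂ} (hz : ‖z‖ < 1) {s : ℝ} (hs : 0 < s) :
    ENNReal.ofReal (2 * Real.pi) * ‖F z‖ₑ ^ s ≤ ∫⁻ ξ : Torus, pk z ξ * ‖F ξ‖ₑ ^ s ∂arcLength := by
  have he : ∀ w, ‖F w‖ₑ ^ s = ENNReal.ofReal (‖F w‖ ^ s) := fun w => by
    rw [← ofReal_norm, ENNReal.ofReal_rpow_of_nonneg (norm_nonneg _) hs.le]
  have h1 : ∀ ξ : Torus, pk z ξ * ‖F ξ‖ₑ ^ s =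
      ENNReal.ofReal (poissonKernel 0 z ξ * ‖F ξ‖ ^ s) := fun ξ => by
    rw [he, pk, ENNReal.ofReal_mul (poissonKernel_nonneg hz ξ.2)]
  simp_rw [h1]
  rw [lintegral_ofReal_arcLength (u := fun ζ => poissonKernel 0 z ζ * ‖F ζ‖ ^ s)
    ((continuousOn_poissonKernel hz).mul
      (((hF.mono Metric.sphere_subset_closedBall).continuousOn).norm.rpow_const
        fun _ _ => Or.inr hs.le))
    (fun ζ hζ => mul_nonneg (poissonKernel_nonneg hz hζ) (by positivity)), he]
  gcongr
  exact norm_rpow_le_circleAverage hF h0 hz hs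

/-- A nonzero analytic function on the disk has no zeros on circles of radius arbitrarily close
to `1`. -/
theorem frequently_forall_ne_zero {f : ℂ → ℂ} (hf : AnalyticOnNhd ℂ f (Metric.ball 0 1))
    {z : ℂ} (hz : z ∈ Metric.ball (0 : ℂ) 1) (hfz : f z ≠ 0) :
    ∃ᶠ r in 𝓝[<] (1 : ℝ), ∀ w : ℂ, ‖w‖ = r → f w ≠ 0 := by
  intro hbad
  push Not at hbad
  obtain ⟨a, ha, hbad⟩ := mem_nhdsLT_iff_exists_Ioo_subset.1 hbad
  obtain ⟨b, hab, hb⟩ := exists_between (show a < 1 from ha)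
  have hfin : ({w | f w = 0} ∩ Metric.closedBall 0 b).Finite := by
    by_contra hinf
    obtain ⟨x, hx, hacc⟩ := Set.Infinite.exists_accPt_of_subset_isCompact hinf
      (isCompact_closedBall (0 : ℂ) b) inter_subset_right
    have hxb : x ∈ Metric.ball (0 : ℂ) 1 := Metric.closedBall_subset_ball hb hx
    have hfr : ∃ᶠ w in 𝓝[≠] x, f w = 0 := by
      have := accPt_iff_frequently_nhdsNE.1 hacc
      exact this.mono fun w hw => hw.1
    exact hfz (hf.eqOn_zero_of_preconnected_of_frequently_eq_zero
      (convex_ball (0 : ℂ) 1).isPreconnected hxb hfr hz)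
  refine (Ioo_infinite hab) ((hfin.image norm).subset fun r hr => ?_)
  obtain ⟨w, hw, hw0⟩ := hbad ⟨hr.1, hr.2.trans hb⟩
  exact ⟨w, ⟨hw0, by simpa [hw] using hr.2.le⟩, hw⟩

/-! ### Poisson majorants for functions in the Hardy space -/

theorem pk_le {z : ℂ} (hz : ‖z‖ < 1) (ξ : Torus) {x : ℝ} (hx : 0 < x) (h : x ≤ ‖(ξ : ℂ) - z‖) :
    pk z ξ ≤ ENNReal.ofReal (2 * (1 - ‖z‖) / x ^ 2) := by
  rw [pk, poissonKernel_def, sub_zero, sub_zero, norm_torus]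
  refine ENNReal.ofReal_le_ofReal (div_le_div₀ ?_ ?_ (by positivity) (by gcongr))
  · linarith
  · nlinarith [norm_nonneg z]

theorem one_sub_norm_le (z : ℂ) (ξ : Torus) : 1 - ‖z‖ ≤ ‖(ξ : ℂ) - z‖ := by
  have := norm_sub_norm_le (ξ : ℂ) z
  rwa [norm_torus] at this

theorem pk_le_const {z : ℂ} (hz : ‖z‖ < 1) (ξ : Torus) :
    pk z ξ ≤ ENNReal.ofReal (2 / (1 - ‖z‖)) := by
  have h : 0 < 1 - ‖z‖ := by linarith
  refine (pk_le hz ξ h (one_sub_norm_le z ξ)).trans (le_of_eq ?_)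
  congr 1; field_simp

theorem measurable_pk (z : ℂ) : Measurable (pk z) := by
  unfold pk poissonKernel
  fun_prop

theorem tendsto_radial_boundary {f : ℂ → ℂ} {ξ : Torus} {l : ℂ}
    (h : Tendsto f (𝓝[Gam ξ] (ξ : ℂ)) (𝓝 l)) :
    Tendsto (fun r : ℝ => f ((r : ℂ) * ξ)) (𝓝[<] 1) (𝓝 l) := by
  refine h.comp (tendsto_nhdsWithin_iff.2 ⟨?_, ?_⟩)
  · have : Tendsto (fun r : ℝ => (r : ℂ) * (ξ : ℂ)) (𝓝 1) (𝓝 (((1 : ℝ) : ℂ) * ξ)) :=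
      (Continuous.tendsto (by fun_prop) 1)
    rw [Complex.ofReal_one, one_mul] at this
    exact this.mono_left nhdsWithin_le_nhds
  · filter_upwards [Ioo_mem_nhdsLT (zero_lt_one (α := ℝ))] with r hr
    have h1 : ‖(r : ℂ) * ξ‖ = r := by
      rw [norm_mul, norm_torus, mul_one, Complex.norm_real, Real.norm_eq_abs, abs_of_pos hr.1]
    have h2 : ‖(ξ : ℂ) - r * ξ‖ = 1 - r := by
      rw [show (ξ : ℂ) - r * ξ = ((1 - r : ℝ) : ℂ) * ξ by push_cast; ring, norm_mul, norm_torus,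
        mul_one, Complex.norm_real, Real.norm_eq_abs, abs_of_pos (by linarith [hr.2])]
    refine ⟨by rw [h1]; exact hr.2, ?_⟩
    rw [h1, h2]; linarith [hr.2]

theorem continuous_dilate {f : ℂ → ℂ} (hf : DifferentiableOn ℂ f (Metric.ball 0 1)) {r : ℝ}
    (hr : r ∈ Ioo (0 : ℝ) 1) : Continuous fun ξ : Torus => f ((r : ℂ) * ξ) := by
  refine hf.continuousOn.comp_continuous (by fun_prop) fun ξ => ?_
  rw [mem_ball_zero_iff, norm_mul, norm_torus, mul_one, Complex.norm_real, Real.norm_eq_abs,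
    abs_of_pos hr.1]
  exact hr.2

/-- For `x ≥ K` the power `x ^ s`, `s < 1`, is dominated by a small multiple of `x`. -/
theorem rpow_le_min_add {x K : ℝ≥0∞} {s : ℝ} (hs : 0 < s) (hs1 : s < 1) (hK : K ≠ 0)
    (hx : x ≠ ∞) : x ^ s ≤ min (x ^ s) (K ^ s) + K ^ (s - 1) * x := by
  rcases le_total x K with h | h
  · rw [min_eq_left (ENNReal.rpow_le_rpow h hs.le)]; exact le_self_add
  · refine le_add_left ?_
    have hx0 : x ≠ 0 := fun h0 => hK (le_zero_iff.1 (h0 ▸ h))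
    calc x ^ s = x ^ (s - 1) * x := by
          conv_rhs => rw [← ENNReal.rpow_one x, ← ENNReal.rpow_mul, one_mul]
          rw [← ENNReal.rpow_add _ _ hx0 hx]
          congr 1; ring
      _ ≤ _ := by
          refine mul_le_mul' ?_ le_rfl
          rw [show s - 1 = -(1 - s) by ring, ENNReal.rpow_neg, ENNReal.rpow_neg,
            ENNReal.inv_le_inv]
          exact ENNReal.rpow_le_rpow h (by linarith)

/-- For `0 < s < 1`, the boundedness of the integral means in `L¹` makes the functions
`|f(rξ)|^s` uniformly integrable, so the Poisson majorant passes to the boundary function. -/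
theorem MemH1.enorm_rpow_le_lintegral {f : ℂ → ℂ} (hf : MemH1 f) {g : Torus → ℂ}
    (hg : IsBoundaryFunction f g) {s : ℝ} (hs : 0 < s) (hs1 : s < 1) {z : ℂ} (hz : ‖z‖ < 1) :
    ENNReal.ofReal (2 * Real.pi) * ‖f z‖ₑ ^ s ≤ ∫⁻ ξ : Torus, pk z ξ * ‖g ξ‖ₑ ^ s ∂arcLength := by
  obtain ⟨hd, hfin⟩ := hf
  have hzb : z ∈ Metric.ball (0 : ℂ) 1 := by simpa using hz
  by_cases hfz : f z = 0
  · rw [hfz, enorm_zero, ENNReal.zero_rpow_of_pos hs, mul_zero]; exact zero_le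
  have han : AnalyticOnNhd ℂ f (Metric.ball 0 1) := hd.analyticOnNhd Metric.isOpen_ball
  have hgood := frequently_forall_ne_zero han hzb hfz
  set P := ENNReal.ofReal (2 / (1 - ‖z‖))
  obtain ⟨M, hM, hMb⟩ : ∃ M : ℝ≥0∞, M ≠ ∞ ∧ ∀ r : ℝ, r ∈ Ioo (0 : ℝ) 1 →
      ∫⁻ ξ : Torus, ‖f ((r : ℂ) * ξ)‖ₑ ∂arcLength ≤ M := by
    refine ⟨_, ENNReal.mul_ne_top (ENNReal.ofReal_ne_top (r := 2 * Real.pi)) hfin.ne, fun r hr => ?_⟩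
    have h := le_iSup₂ (f := fun (r : ℝ) (_ : r ∈ Ioo (0 : ℝ) 1) =>
      ((ENNReal.ofReal (2 * Real.pi))⁻¹ * ∫⁻ ξ : Torus, ‖f ((r : ℂ) * (ξ : ℂ))‖ₑ ∂arcLength)) r hr
    refine le_trans (le_of_eq ?_) (mul_le_mul' le_rfl h)
    rw [← mul_assoc, ENNReal.mul_inv_cancel, one_mul]
    · simp [Real.pi_pos]
    · exact ENNReal.ofReal_ne_top
  -- the estimate on a circle of radius `r` without zeros, truncated at level `K`
  have key : ∀ K : ℝ≥0∞, K ≠ 0 → K ≠ ∞ → ENNReal.ofReal (2 * Real.pi) * ‖f z‖ₑ ^ s ≤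
      (∫⁻ ξ : Torus, pk z ξ * ‖g ξ‖ₑ ^ s ∂arcLength) + K ^ (s - 1) * (P * M) := by
    intro K hK hK'
    have hr : ∃ᶠ r : ℝ in 𝓝[<] (1 : ℝ), ENNReal.ofReal (2 * Real.pi) * ‖f (r * z)‖ₑ ^ s ≤
        (∫⁻ ξ : Torus, pk z ξ * min (‖f ((r : ℂ) * ξ)‖ₑ ^ s) (K ^ s) ∂arcLength) +
          K ^ (s - 1) * (P * M) := by
      refine (hgood.and_eventually (Ioo_mem_nhdsLT (zero_lt_one (α := ℝ)))).mono ?_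
      rintro r ⟨hr0, hr⟩
      have hF : AnalyticOnNhd ℂ (fun w => f (r * w)) (Metric.closedBall 0 1) := by
        intro w hw
        refine AnalyticAt.fun_comp (han _ ?_) (by fun_prop)
        rw [mem_ball_zero_iff, norm_mul, Complex.norm_real, Real.norm_eq_abs, abs_of_pos hr.1]
        rw [mem_closedBall_zero_iff] at hw
        nlinarith [hr.1, hr.2]
      refine (AreaOperator.enorm_rpow_le_lintegral hF (fun ζ hζ => hr0 _ ?_) hz hs).trans ?_
      · rw [norm_mul, mem_sphere_zero_iff_norm.1 hζ, mul_one, Complex.norm_real, Real.norm_eq_abs,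
          abs_of_pos hr.1]
      have hc := continuous_dilate hd hr
      have hm1 : Measurable fun ξ : Torus => ‖f ((r : ℂ) * ξ)‖ₑ := hc.measurable.enorm
      calc _ ≤ ∫⁻ ξ : Torus, (pk z ξ * min (‖f ((r : ℂ) * ξ)‖ₑ ^ s) (K ^ s) +
            K ^ (s - 1) * P * ‖f ((r : ℂ) * ξ)‖ₑ) ∂arcLength := by
            refine lintegral_mono fun ξ => ?_
            calc _ ≤ pk z ξ * (min (‖f ((r : ℂ) * ξ)‖ₑ ^ s) (K ^ s) +
                  K ^ (s - 1) * ‖f ((r : ℂ) * ξ)‖ₑ) := by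
                  gcongr; exact rpow_le_min_add hs hs1 hK enorm_ne_top
              _ = pk z ξ * min (‖f ((r : ℂ) * ξ)‖ₑ ^ s) (K ^ s) +
                  K ^ (s - 1) * pk z ξ * ‖f ((r : ℂ) * ξ)‖ₑ := by ring
              _ ≤ _ := by gcongr; exact pk_le_const hz ξ
        _ = _ := by
            rw [lintegral_add_right _ (hm1.const_mul _), lintegral_const_mul _ hm1]
        _ ≤ _ := by
            rw [mul_assoc]; gcongr; exact hMb r hr
    have hlim1 : Tendsto (fun r : ℝ => ENNReal.ofReal (2 * Real.pi) * ‖f (r * z)‖ₑ ^ s) (𝓝[<] 1)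
        (𝓝 (ENNReal.ofReal (2 * Real.pi) * ‖f z‖ₑ ^ s)) := by
      refine ENNReal.Tendsto.const_mul ?_ (Or.inr ENNReal.ofReal_ne_top)
      refine ((ENNReal.continuous_rpow_const (y := s)).tendsto _).comp
        ((continuous_enorm.tendsto _).comp ?_)
      have h1 : Tendsto (fun r : ℝ => (r : ℂ) * z) (𝓝[<] 1) (𝓝 z) := by
        have : Tendsto (fun r : ℝ => (r : ℂ) * z) (𝓝 1) (𝓝 (((1 : ℝ) : ℂ) * z)) :=
          (Continuous.tendsto (by fun_prop) 1)
        rw [Complex.ofReal_one, one_mul] at this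
        exact this.mono_left nhdsWithin_le_nhds
      exact (han z hzb).continuousAt.tendsto.comp h1
    have hlim2 : Tendsto (fun r : ℝ =>
        ∫⁻ ξ : Torus, pk z ξ * min (‖f ((r : ℂ) * ξ)‖ₑ ^ s) (K ^ s) ∂arcLength) (𝓝[<] 1)
        (𝓝 (∫⁻ ξ : Torus, pk z ξ * min (‖g ξ‖ₑ ^ s) (K ^ s) ∂arcLength)) := by
      refine tendsto_lintegral_filter_of_dominated_convergence (fun _ => P * K ^ s) ?_ ?_ ?_ ?_
      · filter_upwards [Ioo_mem_nhdsLT (zero_lt_one (α := ℝ))] with r hr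
        exact (measurable_pk z).mul
          (((continuous_dilate hd hr).measurable.enorm.pow_const s).min measurable_const)
      · refine Eventually.of_forall fun r => ae_of_all _ fun ξ => ?_
        exact mul_le_mul' (pk_le_const hz ξ) (min_le_right _ _)
      · rw [lintegral_const]
        exact ENNReal.mul_ne_top (ENNReal.mul_ne_top ENNReal.ofReal_ne_top
          (ENNReal.rpow_ne_top_of_nonneg hs.le hK')) (measure_ne_top _ _)
      · filter_upwards [hg] with ξ hξ
        have h1 := tendsto_radial_boundary hξ
        refine ENNReal.Tendsto.const_mul ?_ (Or.inr ENNReal.ofReal_ne_top)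
        exact (((ENNReal.continuous_rpow_const (y := s)).tendsto _).comp
          ((continuous_enorm.tendsto _).comp h1)).min tendsto_const_nhds
    have h3 := le_of_tendsto_of_tendsto_of_frequently hlim1
      (hlim2.add (tendsto_const_nhds (x := K ^ (s - 1) * (P * M)))) hr
    refine h3.trans ?_
    gcongr
    exact min_le_left _ _
  have hPM : P * M ≠ ∞ := ENNReal.mul_ne_top ENNReal.ofReal_ne_top hM
  have hlim : Tendsto (fun n : ℕ => (∫⁻ ξ : Torus, pk z ξ * ‖g ξ‖ₑ ^ s ∂arcLength) +
      ((n + 1 : ℕ) : ℝ≥0∞) ^ (s - 1) * (P * M)) atTop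
      (𝓝 ((∫⁻ ξ : Torus, pk z ξ * ‖g ξ‖ₑ ^ s ∂arcLength) + 0 * (P * M))) := by
    refine tendsto_const_nhds.add (ENNReal.Tendsto.mul_const ?_ (Or.inr hPM))
    have h1 : Tendsto (fun n : ℕ => ((n + 1 : ℕ) : ℝ≥0∞)) atTop (𝓝 ∞) :=
      ENNReal.tendsto_nat_nhds_top.comp (tendsto_add_atTop_nat 1)
    have h2 := ((ENNReal.continuous_rpow_const (y := s - 1)).tendsto ∞).comp h1
    rwa [ENNReal.top_rpow_of_neg (by linarith)] at h2
  rw [zero_mul, add_zero] at hlim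
  exact ge_of_tendsto' hlim fun n => key _ (by simp) (by simp)

theorem IsBoundaryFunction.aemeasurable {f : ℂ → ℂ} (hf : DifferentiableOn ℂ f (Metric.ball 0 1))
    {g : Torus → ℂ} (hg : IsBoundaryFunction f g) : AEMeasurable g arcLength := by
  obtain ⟨x, -, hx1, hx2⟩ := exists_seq_strictMono_tendsto' (zero_lt_one (α := ℝ))
  refine aemeasurable_of_tendsto_metrizable_ae atTop
    (f := fun (n : ℕ) (ξ : Torus) => f ((x n : ℂ) * ξ))
    (fun n => (continuous_dilate hf (hx1 n)).aemeasurable) ?_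
  filter_upwards [hg] with ξ hξ
  refine (tendsto_radial_boundary hξ).comp (tendsto_nhdsWithin_iff.2 ⟨hx2, ?_⟩)
  exact Eventually.of_forall fun n => (hx1 n).2

/-! ### Poisson integrals and averages over tents -/

/-- The Poisson kernel is dominated by a geometrically decreasing combination of indicators of tents,
so Poisson integrals are controlled by means over larger tents with the same direction. -/
theorem lintegral_pk_le {h : Torus → ℝ≥0∞} (hh : AEMeasurable h arcLength) (η : Torus) {d : ℝ}
    (hd : 0 < d) (hd1 : d ≤ 1) {S : ℝ≥0∞}
    (hS : ∀ D, d ≤ D → ∫⁻ ξ in Tent (radial η D), h ξ ∂arcLength ≤ ENNReal.ofReal D * S) :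
    ∫⁻ ξ, pk (radial η d) ξ * h ξ ∂arcLength ≤ 64 * S := by
  set T : ℕ → Set Torus := fun j => Tent (radial η (2 ^ j * d))
  have hT : ∀ j, MeasurableSet (T j) := fun j => measurableSet_tent _
  have hz := norm_disk_lt (radial η d)
  have hnorm : 1 - ‖(radial η d : ℂ)‖ = d := by rw [one_sub_norm_radial η hd, min_eq_left hd1]
  have hex : ∀ ξ, ∃ j, ξ ∈ T j := fun ξ => by
    obtain ⟨j, hj⟩ := pow_unbounded_of_one_lt (1 / d) (one_lt_two (α := ℝ))
    refine ⟨j, ?_⟩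
    simp only [T]
    rw [tent_radial_eq_univ]
    · trivial
    · rw [div_lt_iff₀ hd] at hj; exact hj.le
  have hpk : ∀ ξ, pk (radial η d) ξ * h ξ ≤
      ∑' j, ENNReal.ofReal (32 * (1 / 4) ^ j / d) * (T j).indicator h ξ := by
    intro ξ
    classical
    set j := Nat.find (hex ξ) with hj
    have hjm : ξ ∈ T j := Nat.find_spec (hex ξ)
    refine le_trans ?_ (ENNReal.le_tsum j)
    rw [indicator_of_mem hjm]
    gcongr
    have hlow : 2 ^ j * d / 4 ≤ ‖(ξ : ℂ) - radial η d‖ := by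
      have h1 := one_sub_norm_le (radial η d : ℂ) ξ
      rw [hnorm] at h1
      rcases Nat.eq_zero_or_pos j with h0 | h0
      · rw [h0]; linarith
      · have h2 : ξ ∉ T (j - 1) := Nat.find_min (hex ξ) (by omega)
        have h3 : ξ ∉ Metric.ball η (2 ^ (j - 1) * d) := fun h =>
          h2 (ball_subset_tent η (by positivity) h)
        rw [Metric.mem_ball, not_lt, dist_coe] at h3
        have h4 := norm_sub_le_norm_sub_add_norm_sub (ξ : ℂ) (radial η d) η
        have h5 := norm_torus_sub_radial η hd
        rw [norm_sub_rev, hnorm] at h5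
        have h6 : (2 : ℝ) ^ j = 2 * 2 ^ (j - 1) := by
          rw [← pow_succ']; congr 1; omega
        rw [h6]; linarith
    refine (pk_le hz ξ (by positivity) hlow).trans (ENNReal.ofReal_le_ofReal (le_of_eq ?_))
    rw [hnorm]
    have : ((2 : ℝ) ^ j) ^ 2 = 4 ^ j := by rw [← pow_mul, mul_comm, pow_mul]; norm_num
    rw [div_pow, mul_pow, this, one_div, inv_pow]
    field_simp; norm_num
  calc _ ≤ ∫⁻ ξ, ∑' j, ENNReal.ofReal (32 * (1 / 4) ^ j / d) * (T j).indicator h ξ ∂arcLength :=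
        lintegral_mono hpk
    _ = ∑' j, ENNReal.ofReal (32 * (1 / 4) ^ j / d) * ∫⁻ ξ in T j, h ξ ∂arcLength := by
        rw [lintegral_tsum fun j => (hh.indicator (hT j)).const_mul _]
        refine tsum_congr fun j => ?_
        rw [lintegral_const_mul' _ _ ENNReal.ofReal_ne_top, lintegral_indicator (hT j)]
    _ ≤ ∑' j, ENNReal.ofReal (32 * (1 / 2) ^ j) * S := by
        refine ENNReal.tsum_le_tsum fun j => ?_
        calc _ ≤ ENNReal.ofReal (32 * (1 / 4) ^ j / d) * (ENNReal.ofReal (2 ^ j * d) * S) := by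
              gcongr
              exact hS _ (le_mul_of_one_le_left hd.le (one_le_pow₀ one_le_two))
          _ = _ := by
              rw [← mul_assoc, ← ENNReal.ofReal_mul (by positivity)]
              congr 2
              have : (1 / 4 : ℝ) ^ j * 2 ^ j = (1 / 2) ^ j := by rw [← mul_pow]; norm_num
              rw [← this]; field_simp
    _ = 64 * S := by
        rw [ENNReal.tsum_mul_right]
        congr 1
        rw [← ENNReal.ofReal_tsum_of_nonneg (fun j => by positivity)
          (summable_geometric_two.mul_left _), tsum_mul_left, tsum_geometric_two]
        norm_num

theorem IsA1.weighted_tent_ne_zero {ω : Torus → ℝ≥0} (hA : IsA1 ω) (h0 : weighted ω ≠ 0)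
    (z : Disk) : weighted ω (Tent z) ≠ 0 := by
  obtain ⟨C, hC⟩ := hA.weighted_mul_le
  intro h
  have h1 := hC (expPt 0) 3 (by norm_num) (Tent z) (by
    rw [ball_eq_univ _ (by norm_num)]; exact subset_univ _)
  rw [h, mul_zero, ball_eq_univ _ (by norm_num), le_zero_iff, mul_eq_zero,
    Measure.measure_univ_eq_zero, or_iff_right h0] at h1
  obtain ⟨η, hη⟩ := exists_radial_eq z
  have hd : 0 < 1 - ‖(z : ℂ)‖ := by linarith [norm_disk_lt z]
  have h2 := (le_arcLength_ball η (by linarith [norm_nonneg (z : ℂ), Real.pi_gt_three])).trans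
    (measure_mono (ball_subset_tent η hd))
  rw [hη, h1, le_zero_iff, ENNReal.ofReal_eq_zero] at h2
  linarith

/-- For an `A₁` weight, unweighted integrals over tents are controlled by weighted averages. -/
theorem IsA1.exists_setLIntegral_le {ω : Torus → ℝ≥0} (hω : AEMeasurable ω arcLength)
    (hA : IsA1 ω) (h0 : weighted ω ≠ 0) : ∃ C : ℝ≥0,
    ∀ (h : Torus → ℝ≥0∞) (η : Torus) (d : ℝ), 0 < d →
      ∫⁻ ξ in Tent (radial η d), h ξ ∂arcLength ≤
        ENNReal.ofReal d * (C * tentAvg (weighted ω) h (radial η d)) := by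
  have := hA.isFiniteMeasure
  obtain ⟨C, hC⟩ := hA.exists_lower_bound
  refine ⟨3 * C, fun h η d hd => ?_⟩
  obtain ⟨c, hc, hc'⟩ := hC η (3 * d) (by positivity)
  set T := Tent (radial η d)
  have hT := hA.weighted_tent_ne_zero h0 (radial η d)
  have hsub : T ⊆ Metric.ball η (3 * d) := tent_subset_ball η hd
  have h1 : c * ∫⁻ ξ in T, h ξ ∂arcLength ≤ ∫⁻ ξ in T, h ξ ∂weighted ω := by
    rw [weighted, setLIntegral_withDensity_eq_setLIntegral_mul_non_measurable₀ _
      hω.coe_nnreal_ennreal.restrict _ (measurableSet_tent _) (ae_of_all _ fun _ => by simp)]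
    refine (lintegral_const_mul_le _ _).trans (lintegral_mono_ae ?_)
    filter_upwards [ae_restrict_of_ae_restrict_of_subset hsub hc] with ξ hξ
    exact mul_le_mul' hξ le_rfl
  have h2 : (∫⁻ ξ in T, h ξ ∂arcLength) * weighted ω T ≤
      ENNReal.ofReal d * (3 * C) * ∫⁻ ξ in T, h ξ ∂weighted ω := by
    calc _ ≤ (∫⁻ ξ in T, h ξ ∂arcLength) * (C * ENNReal.ofReal (3 * d) * c) := by
          gcongr; exact (measure_mono hsub).trans hc'
      _ = ENNReal.ofReal d * (3 * C) * (c * ∫⁻ ξ in T, h ξ ∂arcLength) := by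
          rw [ENNReal.ofReal_mul (by norm_num), ENNReal.ofReal_ofNat]; ring
      _ ≤ _ := by gcongr
  rw [← ENNReal.le_div_iff_mul_le (Or.inl hT) (Or.inl (measure_ne_top _ _))] at h2
  refine h2.trans (le_of_eq ?_)
  rw [tentAvg, mul_div_assoc]
  push_cast
  ring

/-! ### The nontangential maximal theorem in weighted Hardy spaces -/

/-- Poisson integrals are dominated by the nontangential maximal function of weighted averages. -/
theorem IsA1.exists_lintegral_pk_le {ω : Torus → ℝ≥0} (hω : AEMeasurable ω arcLength)
    (hA : IsA1 ω) (h0 : weighted ω ≠ 0) : ∃ C : ℝ≥0, ∀ h : Torus → ℝ≥0∞, AEMeasurable h arcLength →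
      ∀ (z : Disk) (ξ : Torus), ξ ∈ Tent z →
        ∫⁻ ζ, pk z ζ * h ζ ∂arcLength ≤ C * ntSup (tentAvg (weighted ω) h) ξ := by
  obtain ⟨C, hC⟩ := hA.exists_setLIntegral_le hω h0
  refine ⟨64 * C, fun h hh z ξ hξ => ?_⟩
  obtain ⟨η, hη⟩ := exists_radial_eq z
  have hd : 0 < 1 - ‖(z : ℂ)‖ := by linarith [norm_disk_lt z]
  have key := lintegral_pk_le hh η hd (by linarith [norm_nonneg (z : ℂ)])
    (S := C * ntSup (tentAvg (weighted ω) h) ξ) fun D hD => by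
      refine (hC h η D (hd.trans_le hD)).trans ?_
      gcongr
      refine le_ntSup _ (tent_radial_mono η hd hD ?_)
      rwa [hη]
  rw [hη] at key
  refine key.trans (le_of_eq ?_)
  push_cast; ring

theorem weighted_absolutelyContinuous (ω : Torus → ℝ≥0) : weighted ω ≪ arcLength :=
  withDensity_absolutelyContinuous _ _

/-- The nontangential maximal function of `f ∈ H^p(ω)` is controlled by the boundary function. -/
theorem IsA1.exists_lintegral_ntSup_enorm_le {ω : Torus → ℝ≥0} (hω : AEMeasurable ω arcLength)
    (hA : IsA1 ω) (h0 : weighted ω ≠ 0) {p : ℝ} (hp : 0 < p) :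
    ∃ C : ℝ≥0, ∀ (f : ℂ → ℂ) (g : Torus → ℂ), MemH1 f → IsBoundaryFunction f g →
      ∫⁻ ξ, ntSup (fun z => ‖f z‖ₑ) ξ ^ p ∂weighted ω ≤ C * ∫⁻ ξ, ‖g ξ‖ₑ ^ p ∂weighted ω := by
  have := hA.isFiniteMeasure
  obtain ⟨D, hD⟩ := hA.exists_doubling
  obtain ⟨s, hs, hs1, hsp⟩ : ∃ s : ℝ, 0 < s ∧ s < 1 ∧ s < p :=
    ⟨min 1 p / 2, by positivity, by linarith [min_le_left 1 p],
      by linarith [min_le_right 1 p, lt_min one_pos hp]⟩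
  have hr : 1 < p / s := by rwa [one_lt_div hs]
  have hr0 : 0 < p / s := by positivity
  obtain ⟨C₁, hC₁⟩ := hA.exists_lintegral_pk_le hω h0
  obtain ⟨C₂, hC₂⟩ := exists_lintegral_ntSup_tentAvg_le hD hr
  refine ⟨C₁ ^ (p / s) * C₂, fun f g hf hg => ?_⟩
  have hgm := hg.aemeasurable hf.1
  set g' := hgm.mk g
  have hgg' : g =ᵐ[arcLength] g' := hgm.ae_eq_mk
  have hg' : IsBoundaryFunction f g' := by
    filter_upwards [hg, hgg'] with ξ h1 h2
    rwa [← h2]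
  have hm : Measurable fun ξ => ‖g' ξ‖ₑ ^ s := hgm.measurable_mk.enorm.pow_const s
  have hpt : ∀ ξ, ntSup (fun z => ‖f z‖ₑ) ξ ^ p ≤
      (C₁ : ℝ≥0∞) ^ (p / s) * ntSup (tentAvg (weighted ω) fun ξ => ‖g' ξ‖ₑ ^ s) ξ ^ (p / s) := by
    intro ξ
    rw [← ENNReal.mul_rpow_of_nonneg _ _ hr0.le]
    set b := (C₁ : ℝ≥0∞) * ntSup (tentAvg (weighted ω) fun ξ => ‖g' ξ‖ₑ ^ s) ξ
    have h1 : ntSup (fun z => ‖f z‖ₑ) ξ ≤ b ^ (1 / s) := by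
      refine iSup₂_le fun z hz => ?_
      have h2 := (hf.enorm_rpow_le_lintegral hg' hs hs1 (norm_disk_lt z)).trans
        (hC₁ _ hm.aemeasurable z ξ hz)
      have h3 : ‖f z‖ₑ ^ s ≤ b := by
        refine le_trans (le_mul_of_one_le_left' ?_) h2
        rw [ENNReal.one_le_ofReal]; linarith [Real.pi_gt_three]
      rwa [one_div, ENNReal.le_rpow_inv_iff hs]
    calc _ ≤ (b ^ (1 / s)) ^ p := by gcongr
      _ = _ := by rw [← ENNReal.rpow_mul]; congr 1; field_simp
  calc _ ≤ ∫⁻ ξ, (C₁ : ℝ≥0∞) ^ (p / s) *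
        ntSup (tentAvg (weighted ω) fun ξ => ‖g' ξ‖ₑ ^ s) ξ ^ (p / s) ∂weighted ω :=
        lintegral_mono hpt
    _ ≤ (C₁ : ℝ≥0∞) ^ (p / s) * (C₂ * ∫⁻ ξ, (‖g' ξ‖ₑ ^ s) ^ (p / s) ∂weighted ω) := by
        rw [lintegral_const_mul _ ((measurable_ntSup _).pow_const _)]
        gcongr
        exact hC₂ _ hm
    _ = _ := by
        rw [ENNReal.coe_mul, ENNReal.coe_rpow_of_nonneg _ hr0.le, mul_assoc]
        congr 2
        refine lintegral_congr_ae ?_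
        filter_upwards [(weighted_absolutelyContinuous ω).ae_le hgg'] with ξ h
        rw [h, ← ENNReal.rpow_mul]
        congr 1; field_simp

/-! ### The area operator of a measure on the disk -/

/-- The area operator `h ↦ ∫_{Γ(ξ)} h dm` of a measure `m` on the disk. -/
def area (m : Measure Disk) (h : Disk → ℝ≥0∞) (ξ : Torus) : ℝ≥0∞ :=
  ∫⁻ z in {z | ξ ∈ Tent z}, h z ∂m

/-- The measure `dμ(z) / ν(T(z))`. -/
def reduced (μ : Measure Disk) (ν : Measure Torus) : Measure Disk :=
  μ.withDensity fun z => (ν (Tent z))⁻¹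

theorem areaOp_eq_area (μ : Measure Disk) (ν : Measure Torus) {f : ℂ → ℂ}
    (hf : Measurable fun z : Disk => ‖f z‖ₑ) :
    areaOp μ ν f = area (reduced μ ν) fun z => ‖f z‖ₑ := by
  ext ξ
  have hm : Measurable fun z => (ν (Tent z))⁻¹ := (measurable_measure_tent ν).inv
  rw [area, reduced, setLIntegral_withDensity_eq_setLIntegral_mul _ hm hf
    (isOpen_setOf_tent ξ).measurableSet]
  refine setLIntegral_congr_fun (isOpen_setOf_tent ξ).measurableSet fun z _ => ?_
  rw [Pi.mul_apply, mul_comm, div_eq_mul_inv]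

theorem muNuOmega_eq (μ : Measure Disk) (ν : Measure Torus) (ω : Torus → ℝ≥0) :
    muNuOmega μ ν ω = (reduced μ ν).withDensity fun z => weighted ω (Tent z) := by
  have hm : Measurable fun z => (ν (Tent z))⁻¹ := (measurable_measure_tent ν).inv
  rw [reduced, ← withDensity_mul _ hm (measurable_measure_tent _),
    muNuOmega]
  congr 1
  ext z
  rw [Pi.mul_apply, wMass_eq, mul_comm, div_eq_mul_inv]

theorem wNorm_eq {ω : Torus → ℝ≥0} (hω : AEMeasurable ω arcLength) (p : ℝ) (F : Torus → ℝ≥0∞) :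
    wNorm ω p F =
      ((ENNReal.ofReal (2 * Real.pi))⁻¹ * ∫⁻ ξ, F ξ ^ p ∂weighted ω) ^ (1 / p) := by
  rw [wNorm, weighted, lintegral_withDensity_eq_lintegral_mul_non_measurable₀ _
    hω.coe_nnreal_ennreal (ae_of_all _ fun _ => by simp)]
  simp only [Pi.mul_apply, mul_comm]

theorem area_eq_lintegral_indicator (m : Measure Disk) (h : Disk → ℝ≥0∞) (ξ : Torus) :
    area m h ξ = ∫⁻ z, {x : Torus × Disk | x.1 ∈ Tent x.2}.indicator (fun x => h x.2) (ξ, z) ∂m := by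
  rw [area, ← lintegral_indicator (isOpen_setOf_tent ξ).measurableSet]
  rfl

theorem measurable_indicator_tent {h : Disk → ℝ≥0∞} (hh : Measurable h) : Measurable
    fun y => {x : Torus × Disk | x.1 ∈ Tent x.2}.indicator (fun x => h x.2) y :=
  (hh.comp measurable_snd).indicator isOpen_setOf_mem_tent.measurableSet

theorem measurable_area (m : Measure Disk) [SFinite m] {h : Disk → ℝ≥0∞} (hh : Measurable h) :
    Measurable (area m h) := by
  have : area m h = fun ξ => ∫⁻ z, {x : Torus × Disk | x.1 ∈ Tent x.2}.indicator
      (fun x => h x.2) (ξ, z) ∂m := funext fun ξ => area_eq_lintegral_indicator m h ξ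
  rw [this]
  exact (measurable_indicator_tent hh).lintegral_prod_right'

/-- Tonelli's theorem for the area operator. -/
theorem lintegral_area_mul (m : Measure Disk) [SFinite m] (W : Measure Torus) [SFinite W]
    {h : Disk → ℝ≥0∞} (hh : Measurable h) {k : Torus → ℝ≥0∞} (hk : Measurable k) :
    ∫⁻ ξ, area m h ξ * k ξ ∂W = ∫⁻ z, h z * ∫⁻ ξ in Tent z, k ξ ∂W ∂m := by
  have h1 : ∀ ξ, area m h ξ * k ξ = ∫⁻ z, {x : Torus × Disk | x.1 ∈ Tent x.2}.indicator
      (fun x => h x.2) (ξ, z) * k ξ ∂m := fun ξ => by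
    have hm : Measurable fun z => {x : Torus × Disk | x.1 ∈ Tent x.2}.indicator
        (fun x => h x.2) (ξ, z) := (measurable_indicator_tent hh).comp measurable_prodMk_left
    rw [area_eq_lintegral_indicator, lintegral_mul_const _ hm]
  simp_rw [h1]
  rw [lintegral_lintegral_swap ((measurable_indicator_tent hh).mul
    (hk.comp measurable_fst)).aemeasurable]
  refine lintegral_congr fun z => ?_
  rw [← lintegral_indicator (measurableSet_tent z),
    ← lintegral_const_mul _ (hk.indicator (measurableSet_tent z))]
  refine lintegral_congr fun ξ => ?_
  by_cases hξ : ξ ∈ Tent z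
  · rw [indicator_of_mem (by exact hξ), indicator_of_mem hξ]
  · rw [indicator_of_notMem (by exact hξ), indicator_of_notMem hξ, zero_mul, mul_zero]

/-! ### Sufficiency of the Carleson condition -/

theorem lintegral_rpow_mul_le_of_carleson {W : Measure Torus} [IsFiniteMeasure W] {D : ℝ≥0}
    (hD : Doubling W D) {τ : Measure Disk} [SFinite τ] {K : ℝ≥0∞} {t : ℝ} (ht : 1 ≤ t)
    (hτ : ∀ w, τ (box (Tent w)) ≤ K * W (Tent w) ^ t) {F : Disk → ℝ≥0∞} (hF : Measurable F)
    {b : ℝ} (hb : 0 < b) :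
    ∫⁻ z, F z ^ (b * t) ∂τ ≤
      K * (D : ℝ≥0∞) ^ t * ENNReal.ofReal t * (∫⁻ ξ, ntSup F ξ ^ b ∂W) ^ t := by
  have h := lintegral_rpow_le_of_carleson hD ht hτ (hF.pow_const b)
  simp_rw [← ENNReal.rpow_mul] at h
  refine h.trans ?_
  have : 0 ≤ t := by linarith
  gcongr with ξ
  exact iSup₂_le fun z hz => ENNReal.rpow_le_rpow (le_ntSup F hz) hb.le

/-- Boundedness of the area operator for `q ≤ 1`, by interpolating `F` between its nontangential
maximal function and the power that the Carleson embedding controls. -/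
theorem lintegral_area_rpow_le_of_le_one {W : Measure Torus} [IsFiniteMeasure W] {D : ℝ≥0}
    (hD : Doubling W D) {m : Measure Disk} [SFinite m] {K : ℝ≥0∞} (hK : K ≠ ∞) {p q t : ℝ}
    (hp : 0 < p) (hpq : p ≤ q) (hq : q ≤ 1) (ht : t = 1 + 1 / p - 1 / q)
    (hτ : ∀ w, (m.withDensity fun z => W (Tent z)) (box (Tent w)) ≤ K * W (Tent w) ^ t) :
    ∃ C : ℝ≥0∞, C ≠ ∞ ∧ ∀ F : Disk → ℝ≥0∞, Measurable F →
      ∫⁻ ξ, area m F ξ ^ q ∂W ≤ C * (∫⁻ ξ, ntSup F ξ ^ p ∂W) ^ (q / p) := by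
  have hq0 : 0 < q := hp.trans_le hpq
  have ht1 : 1 ≤ t := by
    rw [ht]; have := one_div_le_one_div_of_le hp hpq; linarith
  set s := p * t with hs
  have hs' : s = p + 1 - p / q := by rw [hs, ht]; field_simp
  have hs0 : 0 ≤ s := by positivity
  have hs1 : s ≤ 1 := by
    have : p ≤ p / q := by rw [le_div_iff₀ hq0]; nlinarith
    linarith
  set E := K * (D : ℝ≥0∞) ^ t * ENNReal.ofReal t
  have hE : E ≠ ∞ := by
    have : (D : ℝ≥0∞) ^ t ≠ ∞ := ENNReal.rpow_ne_top_of_nonneg (by linarith) ENNReal.coe_ne_top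
    finiteness
  refine ⟨E ^ q, ENNReal.rpow_ne_top_of_nonneg hq0.le hE, fun F hF => ?_⟩
  set A := ∫⁻ ξ, ntSup F ξ ^ p ∂W
  have hFs : Measurable fun z => F z ^ s := hF.pow_const s
  have hpt : ∀ ξ, area m F ξ ^ q ≤ (ntSup F ξ ^ p) ^ (1 - q) * area m (fun z => F z ^ s) ξ ^ q := by
    intro ξ
    have h1 : area m F ξ ≤ ntSup F ξ ^ (1 - s) * area m (fun z => F z ^ s) ξ := by
      rw [area, area, ← lintegral_const_mul _ hFs]
      refine setLIntegral_mono' (isOpen_setOf_tent ξ).measurableSet fun z hz => ?_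
      calc F z = F z ^ (1 - s) * F z ^ s := by
            rw [← ENNReal.rpow_add_of_nonneg _ _ (by linarith) hs0, sub_add_cancel,
              ENNReal.rpow_one]
        _ ≤ _ := by
            have : 0 ≤ 1 - s := by linarith
            gcongr
            exact le_ntSup F hz
    calc _ ≤ (ntSup F ξ ^ (1 - s) * area m (fun z => F z ^ s) ξ) ^ q := by gcongr
      _ = _ := by
          rw [ENNReal.mul_rpow_of_nonneg _ _ hq0.le, ← ENNReal.rpow_mul, ← ENNReal.rpow_mul]
          congr 2
          rw [hs']; field_simp; ring
  have hint : ∫⁻ ξ, area m (fun z => F z ^ s) ξ ∂W ≤ E * A ^ t := by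
    have h1 := lintegral_area_mul m W hFs (k := fun _ => 1) measurable_const
    simp only [mul_one, setLIntegral_one] at h1
    rw [h1]
    have h2 := lintegral_rpow_mul_le_of_carleson hD ht1 hτ hF hp
    rw [lintegral_withDensity_eq_lintegral_mul _ (measurable_measure_tent W) hFs] at h2
    refine le_trans (le_of_eq (lintegral_congr fun z => ?_)) h2
    rw [Pi.mul_apply, mul_comm]
  calc _ ≤ ∫⁻ ξ, (ntSup F ξ ^ p) ^ (1 - q) * area m (fun z => F z ^ s) ξ ^ q ∂W :=
        lintegral_mono hpt
    _ ≤ A ^ (1 - q) * (∫⁻ ξ, area m (fun z => F z ^ s) ξ ∂W) ^ q :=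
        ENNReal.lintegral_mul_norm_pow_le ((measurable_ntSup F).pow_const p).aemeasurable
          (measurable_area m hFs).aemeasurable (by linarith) hq0.le (by ring)
    _ ≤ A ^ (1 - q) * (E * A ^ t) ^ q := by gcongr
    _ = E ^ q * A ^ (q / p) := by
        rw [ENNReal.mul_rpow_of_nonneg _ _ hq0.le, ← ENNReal.rpow_mul, mul_left_comm,
          ← ENNReal.rpow_add_of_nonneg _ _ (by linarith) (by positivity)]
        congr 2
        rw [ht]; field_simp; ring

/-- The dual estimate behind the case `q > 1`: the area operator is tested against functions in
the dual Lebesgue space, whose averages over tents are controlled by the maximal theorem. -/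
theorem lintegral_area_mul_le {W : Measure Torus} [IsFiniteMeasure W] {D : ℝ≥0}
    (hD : Doubling W D) (hW : ∀ z, W (Tent z) ≠ 0) {m : Measure Disk} [SFinite m] {K : ℝ≥0∞}
    (hK : K ≠ ∞) {p q q' t : ℝ} (hp : 0 < p) (hpq : p ≤ q) (hqq : q.HolderConjugate q')
    (ht : t = 1 + 1 / p - 1 / q)
    (hτ : ∀ w, (m.withDensity fun z => W (Tent z)) (box (Tent w)) ≤ K * W (Tent w) ^ t) :
    ∃ C : ℝ≥0∞, C ≠ ∞ ∧ ∀ F : Disk → ℝ≥0∞, Measurable F → ∀ k : Torus → ℝ≥0∞, Measurable k →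
      ∫⁻ ξ, area m F ξ * k ξ ∂W ≤
        C * (∫⁻ ξ, ntSup F ξ ^ p ∂W) ^ (1 / p) * (∫⁻ ξ, k ξ ^ q' ∂W) ^ (1 / q') := by
  have hq0 : 0 < q := hqq.pos
  have hq0' : 0 < q' := hqq.symm.pos
  have ht1 : 1 ≤ t := by
    rw [ht]; have := one_div_le_one_div_of_le hp hpq; linarith
  have ht0 : 0 < t := by linarith
  set E := K * (D : ℝ≥0∞) ^ t * ENNReal.ofReal t
  have hE : E ≠ ∞ := by
    have : (D : ℝ≥0∞) ^ t ≠ ∞ := ENNReal.rpow_ne_top_of_nonneg (by linarith) ENNReal.coe_ne_top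
    finiteness
  obtain ⟨M, hM⟩ := exists_lintegral_ntSup_tentAvg_le hD hqq.symm.lt
  have hconj : (p * t).HolderConjugate (q' * t) := by
    have h := hqq.inv_add_inv_eq_one
    have h1 : 1 / q + 1 / q' = 1 := by simpa using h
    have h2 : t = 1 / p + 1 / q' := by rw [ht]; linarith
    refine Real.holderConjugate_iff.2 ⟨?_, ?_⟩
    · rw [h2, mul_add, mul_one_div_cancel hp.ne']
      have : 0 < p * (1 / q') := by positivity
      linarith
    · have : (p * t)⁻¹ + (q' * t)⁻¹ = (1 / p + 1 / q') / t := by field_simp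
      rw [this, ← h2, div_self ht0.ne']
  refine ⟨E ^ (1 / (p * t)) * (E * M ^ t) ^ (1 / (q' * t)), ?_, fun F hF k hk => ?_⟩
  · have h1 : E ^ (1 / (p * t)) ≠ ∞ := ENNReal.rpow_ne_top_of_nonneg (by positivity) hE
    have h2 : (M : ℝ≥0∞) ^ t ≠ ∞ := ENNReal.rpow_ne_top_of_nonneg ht0.le ENNReal.coe_ne_top
    have h3 : (E * M ^ t) ^ (1 / (q' * t)) ≠ ∞ :=
      ENNReal.rpow_ne_top_of_nonneg (by positivity) (ENNReal.mul_ne_top hE h2)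
    exact ENNReal.mul_ne_top h1 h3
  set A := ∫⁻ ξ, ntSup F ξ ^ p ∂W
  set B := ∫⁻ ξ, k ξ ^ q' ∂W
  have hmT := measurable_measure_tent W
  have hk' := measurable_tentAvg W k
  have e1 : ∫⁻ ξ, area m F ξ * k ξ ∂W =
      ∫⁻ z, (F * tentAvg W k) z ∂m.withDensity fun z => W (Tent z) := by
    rw [lintegral_area_mul m W hF hk, lintegral_withDensity_eq_lintegral_mul _ hmT (hF.mul hk')]
    refine lintegral_congr fun z => ?_
    rw [Pi.mul_apply, Pi.mul_apply, tentAvg, mul_left_comm,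
      ENNReal.mul_div_cancel (hW z) (measure_ne_top _ _)]
  rw [e1]
  calc _ ≤ _ := ENNReal.lintegral_mul_le_Lp_mul_Lq _ hconj hF.aemeasurable hk'.aemeasurable
    _ ≤ (E * A ^ t) ^ (1 / (p * t)) * (E * (M * B) ^ t) ^ (1 / (q' * t)) := by
        gcongr
        · exact lintegral_rpow_mul_le_of_carleson hD ht1 hτ hF hp
        · refine (lintegral_rpow_mul_le_of_carleson hD ht1 hτ hk' hq0').trans ?_
          gcongr
          exact hM k hk
    _ = _ := by
        rw [ENNReal.mul_rpow_of_nonneg _ _ ht0.le, ← mul_assoc E,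
          ENNReal.mul_rpow_of_nonneg _ _ (show 0 ≤ 1 / (p * t) by positivity),
          ENNReal.mul_rpow_of_nonneg (E * (M : ℝ≥0∞) ^ t) _ (show 0 ≤ 1 / (q' * t) by positivity),
          ← ENNReal.rpow_mul A, ← ENNReal.rpow_mul B]
        have h1 : t * (1 / (p * t)) = 1 / p := by field_simp
        have h2 : t * (1 / (q' * t)) = 1 / q' := by field_simp
        rw [h1, h2]; ring

/-- Boundedness of the area operator for `q > 1`, by duality. -/
theorem lintegral_area_rpow_le_of_one_lt {W : Measure Torus} [IsFiniteMeasure W] {D : ℝ≥0}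
    (hD : Doubling W D) (hW : ∀ z, W (Tent z) ≠ 0) {m : Measure Disk} [SFinite m] {K : ℝ≥0∞}
    (hK : K ≠ ∞) {p q t : ℝ} (hp : 0 < p) (hpq : p ≤ q) (hq : 1 < q)
    (ht : t = 1 + 1 / p - 1 / q)
    (hτ : ∀ w, (m.withDensity fun z => W (Tent z)) (box (Tent w)) ≤ K * W (Tent w) ^ t) :
    ∃ C : ℝ≥0∞, C ≠ ∞ ∧ ∀ F : Disk → ℝ≥0∞, Measurable F →
      ∫⁻ ξ, area m F ξ ^ q ∂W ≤ C * (∫⁻ ξ, ntSup F ξ ^ p ∂W) ^ (q / p) := by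
  have hq0 : 0 < q := by linarith
  have hq1 : 0 < q - 1 := by linarith
  have hqq := Real.HolderConjugate.conjExponent hq
  obtain ⟨C, hC, hCk⟩ := lintegral_area_mul_le hD hW hK hp hpq hqq ht hτ
  refine ⟨C ^ q, ENNReal.rpow_ne_top_of_nonneg hq0.le hC, fun F hF => ?_⟩
  set A := ∫⁻ ξ, ntSup F ξ ^ p ∂W
  have hma := measurable_area m hF
  -- truncation makes the integral on both sides of the dual estimate finite
  have htrunc : ∀ n : ℕ, ∫⁻ ξ, min (area m F ξ) n ^ q ∂W ≤ C ^ q * A ^ (q / p) := by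
    intro n
    set B : Torus → ℝ≥0∞ := fun ξ => min (area m F ξ) n
    have hmB : Measurable B := hma.min measurable_const
    set X := ∫⁻ ξ, B ξ ^ q ∂W
    have hX : X ≠ ∞ := by
      refine ne_top_of_le_ne_top ?_ (lintegral_mono (g := fun _ => (n : ℝ≥0∞) ^ q) fun ξ =>
        ENNReal.rpow_le_rpow (min_le_right _ _) hq0.le)
      rw [lintegral_const]
      exact ENNReal.mul_ne_top (ENNReal.rpow_ne_top_of_nonneg hq0.le (by simp))
        (measure_ne_top _ _)
    have h1 := hCk F hF (fun ξ => B ξ ^ (q - 1)) (hmB.pow_const _)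
    have e1 : (q - 1) * q.conjExponent = q := by rw [Real.conjExponent]; field_simp
    simp_rw [← ENNReal.rpow_mul, e1] at h1
    have h2 : X ≤ C * A ^ (1 / p) * X ^ (1 / q.conjExponent) := by
      refine le_trans (lintegral_mono fun ξ => ?_) h1
      calc B ξ ^ q = B ξ * B ξ ^ (q - 1) := by
            nth_rw 2 [← ENNReal.rpow_one (B ξ)]
            rw [← ENNReal.rpow_add_of_nonneg _ _ zero_le_one hq1.le]
            congr 1; ring
        _ ≤ _ := by gcongr; exact min_le_left _ _
    by_cases hX0 : X = 0
    · rw [hX0]; exact zero_le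
    have e2 : X = X ^ (1 / q) * X ^ (1 / q.conjExponent) := by
      rw [← ENNReal.rpow_add _ _ hX0 hX]
      have := hqq.inv_add_inv_eq_one
      rw [one_div, one_div, this, ENNReal.rpow_one]
    nth_rw 1 [e2] at h2
    have h3 : X ^ (1 / q) ≤ C * A ^ (1 / p) := by
      refine (ENNReal.mul_le_mul_iff_left ?_ ?_).1 h2
      · simp [ENNReal.rpow_eq_zero_iff, hX0, hX]
      · exact ENNReal.rpow_ne_top_of_nonneg (by have := hqq.symm.pos; positivity) hX
    calc X = (X ^ (1 / q)) ^ q := by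
          rw [← ENNReal.rpow_mul, one_div_mul_cancel hq0.ne', ENNReal.rpow_one]
      _ ≤ (C * A ^ (1 / p)) ^ q := by gcongr
      _ = _ := by
          rw [ENNReal.mul_rpow_of_nonneg _ _ hq0.le, ← ENNReal.rpow_mul]
          congr 2; ring
  have hlim : ∀ ξ, area m F ξ ^ q = liminf (fun n : ℕ => min (area m F ξ) n ^ q) atTop := by
    intro ξ
    refine (Tendsto.liminf_eq ?_).symm
    have h1 : Tendsto (fun n : ℕ => min (area m F ξ) n) atTop (𝓝 (min (area m F ξ) ∞)) :=
      tendsto_const_nhds.min ENNReal.tendsto_nat_nhds_top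
    rw [min_eq_left le_top] at h1
    exact ((ENNReal.continuous_rpow_const (y := q)).tendsto _).comp h1
  simp_rw [hlim]
  refine (lintegral_liminf_le fun n => (hma.min measurable_const).pow_const q).trans ?_
  exact liminf_le_of_frequently_le' (Frequently.of_forall htrunc)

theorem measurable_enorm_disk {f : ℂ → ℂ} (hf : DifferentiableOn ℂ f (Metric.ball 0 1)) :
    Measurable fun z : Disk => ‖f z‖ₑ :=
  (continuousOn_iff_continuous_domRestrict.1 hf.continuousOn).measurable.enorm

theorem tent_zero : Tent (0 : Disk) = univ := by
  have : radial (expPt 0) 1 = 0 := Subtype.ext (by rw [coe_radial _ one_pos]; simp)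
  rw [← this, tent_radial_eq_univ _ le_rfl]

/-- A Carleson box condition makes the measure `dμ(z) / ν(T(z))` s-finite, although `μ` and `ν` are
arbitrary: weighting it by the positive finite function `z ↦ W(T(z))` gives a finite measure. -/
theorem sFinite_of_carleson {W : Measure Torus} [IsFiniteMeasure W] (hW : ∀ z, W (Tent z) ≠ 0)
    {m : Measure Disk} {K : ℝ≥0∞} (hK : K ≠ ∞) {t : ℝ} (ht : 0 ≤ t)
    (hτ : ∀ w, (m.withDensity fun z => W (Tent z)) (box (Tent w)) ≤ K * W (Tent w) ^ t) :
    SFinite m := by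
  set τ := m.withDensity fun z => W (Tent z) with hτdef
  have : IsFiniteMeasure τ := by
    refine ⟨?_⟩
    have h := hτ 0
    have e : box (Tent (0 : Disk)) = univ := by
      rw [tent_zero]; exact eq_univ_of_forall fun z => subset_univ _
    rw [e] at h
    refine h.trans_lt (ENNReal.mul_lt_top hK.lt_top ?_)
    exact ENNReal.rpow_lt_top_of_nonneg ht (measure_ne_top _ _)
  have h := withDensity_inv_same₀ (μ := m) (measurable_measure_tent W).aemeasurable
    (ae_of_all _ hW) (ae_of_all _ fun z => measure_ne_top _ _)
  rw [← h]
  infer_instance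

/-- The Carleson condition implies boundedness of the area operator. -/
theorem areaOpBounded_of_carleson {μ : Measure Disk} {ν : Measure Torus} {ω : Torus → ℝ≥0}
    (hω : AEMeasurable ω arcLength) (hA : IsA1 ω) (h0 : weighted ω ≠ 0) {p q : ℝ} (hp : 0 < p)
    (hpq : p ≤ q) {K : ℝ≥0∞} (hK : K ≠ ∞)
    (hτ : ∀ w, muNuOmega μ ν ω (box (Tent w)) ≤ K * weighted ω (Tent w) ^ (1 + 1 / p - 1 / q)) :
    AreaOpBounded μ ν ω p q := by
  have := hA.isFiniteMeasure
  have hq : 0 < q := hp.trans_le hpq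
  obtain ⟨D, hD⟩ := hA.exists_doubling
  have hW := hA.weighted_tent_ne_zero h0
  rw [muNuOmega_eq] at hτ
  have ht : 0 ≤ 1 + 1 / p - 1 / q := by
    have := one_div_le_one_div_of_le hp hpq; linarith
  have := sFinite_of_carleson hW hK ht hτ
  obtain ⟨C₁, hC₁, h₁⟩ : ∃ C : ℝ≥0∞, C ≠ ∞ ∧ ∀ F : Disk → ℝ≥0∞, Measurable F →
      ∫⁻ ξ, area (reduced μ ν) F ξ ^ q ∂weighted ω ≤
        C * (∫⁻ ξ, ntSup F ξ ^ p ∂weighted ω) ^ (q / p) := by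
    rcases le_or_gt q 1 with h | h
    · exact lintegral_area_rpow_le_of_le_one hD hK hp hpq h rfl hτ
    · exact lintegral_area_rpow_le_of_one_lt hD hW hK hp hpq h rfl hτ
  obtain ⟨C₂, h₂⟩ := hA.exists_lintegral_ntSup_enorm_le hω h0 hp
  set c := (ENNReal.ofReal (2 * Real.pi))⁻¹
  have hc0 : c ≠ 0 := ENNReal.inv_ne_zero.2 ENNReal.ofReal_ne_top
  have hc1 : c ≠ ∞ := by
    refine ENNReal.inv_ne_top.2 ?_
    simp [Real.pi_pos]
  set M := (c * C₁ * C₂ ^ (q / p)) ^ (1 / q) * (c⁻¹) ^ (1 / p)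
  have hM : M ≠ ∞ := by
    have e1 : (C₂ : ℝ≥0∞) ^ (q / p) ≠ ∞ :=
      ENNReal.rpow_ne_top_of_nonneg (by positivity) ENNReal.coe_ne_top
    refine ENNReal.mul_ne_top (ENNReal.rpow_ne_top_of_nonneg (by positivity)
      (ENNReal.mul_ne_top (ENNReal.mul_ne_top hc1 hC₁) e1))
      (ENNReal.rpow_ne_top_of_nonneg (by positivity) (ENNReal.inv_ne_top.2 hc0))
  refine ⟨M.toNNReal + 1, by positivity, fun f g hfg => ?_⟩
  obtain ⟨hf, hg, -⟩ := hfg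
  have hm := measurable_enorm_disk hf.1
  rw [wNorm_eq hω, wNorm_eq hω, areaOp_eq_area μ ν hm]
  set Y := ∫⁻ ξ, ‖g ξ‖ₑ ^ p ∂weighted ω
  have hstep : ∫⁻ ξ, area (reduced μ ν) (fun z => ‖f z‖ₑ) ξ ^ q ∂weighted ω ≤
      C₁ * (C₂ * Y) ^ (q / p) := by
    refine (h₁ _ hm).trans ?_
    gcongr
    exact h₂ f g hf hg
  calc _ ≤ (c * (C₁ * (C₂ * Y) ^ (q / p))) ^ (1 / q) := by gcongr
    _ = M * (c * Y) ^ (1 / p) := by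
        have e1 : (0 : ℝ) ≤ q / p := by positivity
        have e2 : (0 : ℝ) ≤ 1 / q := by positivity
        have e3 : (0 : ℝ) ≤ 1 / p := by positivity
        rw [ENNReal.mul_rpow_of_nonneg _ _ e1, ← mul_assoc, ← mul_assoc,
          ENNReal.mul_rpow_of_nonneg (c * C₁ * _) _ e2, ← ENNReal.rpow_mul Y]
        simp only [M]
        have e4 : c⁻¹ ^ (1 / p) * (c * Y) ^ (1 / p) = Y ^ (1 / p) := by
          rw [← ENNReal.mul_rpow_of_nonneg _ _ e3, ← mul_assoc,
            ENNReal.inv_mul_cancel hc0 hc1, one_mul]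
        have e5 : q / p * (1 / q) = 1 / p := by field_simp
        rw [e5, ← e4, ← mul_assoc]
    _ ≤ _ := by
        gcongr
        rw [ENNReal.coe_add, ENNReal.coe_toNNReal hM]
        exact le_self_add

/-! ### Necessity of the Carleson condition: the measure-theoretic part -/

theorem isClosed_box (U : Set Torus) : IsClosed (box U) := by
  have : (box U)ᶜ = ⋃ ξ ∈ Uᶜ, {z | ξ ∈ Tent z} := by
    ext z
    simp only [box, mem_compl_iff, mem_ofPred_eq, mem_iUnion, exists_prop, not_subset]
    exact exists_congr fun ξ => and_comm
  rw [← isOpen_compl_iff, this]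
  exact isOpen_biUnion fun ξ _ => isOpen_setOf_tent ξ

/-- The closed disk of radius `ρ`, as a subset of the unit disk. -/
def closedDisk (ρ : ℝ) : Set Disk := {z | ‖(z : ℂ)‖ ≤ ρ}

theorem isCompact_closedDisk {ρ : ℝ} (hρ : ρ < 1) : IsCompact (closedDisk ρ) := by
  rw [Subtype.isCompact_iff]
  convert isCompact_closedBall (0 : ℂ) ρ using 1
  ext z
  simp only [closedDisk, mem_image, mem_ofPred_eq, Subtype.exists, exists_and_right,
    mem_closedBall_zero_iff]
  constructor
  · rintro ⟨a, ⟨_, h⟩, rfl⟩; exact h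
  · exact fun h => ⟨z, ⟨by rw [mem_ball_zero_iff]; linarith, h⟩, rfl⟩

/-- Measurability of `ξ ↦ m {z | ξ ∈ T(z)}`, which is not available yet, is not needed here: if
this function were infinite at all points of the open set `T(z)`, its lower integral would be
infinite. -/
theorem isLocallyFiniteMeasure_of_lintegral {W : Measure Torus} (hW : ∀ z, W (Tent z) ≠ 0)
    {m : Measure Disk} {q : ℝ} (hq : 0 < q) (h : ∫⁻ ξ, m {z | ξ ∈ Tent z} ^ q ∂W ≠ ∞) :
    IsLocallyFiniteMeasure m := by
  refine ⟨fun z => ?_⟩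
  obtain ⟨ξ, hξ, hξ'⟩ : ∃ ξ ∈ Tent z, m {z | ξ ∈ Tent z} < ∞ := by
    by_contra hcon
    push Not at hcon
    refine h (top_le_iff.1 ?_)
    calc ∞ = ∫⁻ ξ in Tent z, ∞ ∂W := by rw [setLIntegral_const, ENNReal.top_mul (hW z)]
      _ ≤ ∫⁻ ξ in Tent z, m {z | ξ ∈ Tent z} ^ q ∂W :=
          setLIntegral_mono' (measurableSet_tent z) fun ξ hξ => by
            rw [top_le_iff.1 (hcon ξ hξ), ENNReal.top_rpow_of_pos hq]
      _ ≤ _ := setLIntegral_le_lintegral _ _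
  exact ⟨_, (isOpen_setOf_tent ξ).mem_nhds hξ, hξ'⟩

theorem area_indicator_eq_zero {m : Measure Disk} {U : Set Torus} {ξ : Torus} (h : ξ ∉ U) :
    area m ((box U).indicator 1) ξ = 0 := by
  rw [area, setLIntegral_eq_zero (isOpen_setOf_tent ξ).measurableSet]
  intro z hz
  rw [indicator_of_notMem]
  · rfl
  · exact fun hzU => h (hzU hz)

theorem sub_half_le {a b : ℝ≥0∞} (ha : a ≠ ∞) (h : a ≤ b + a / 2) : a ≤ 2 * b := by
  have h1 : a / 2 ≤ b := by
    have h2 : a / 2 + a / 2 ≤ b + a / 2 := by rwa [ENNReal.add_halves]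
    exact (ENNReal.add_le_add_iff_right (ENNReal.div_ne_top ha (by simp))).1 h2
  calc a = a / 2 + a / 2 := (ENNReal.add_halves a).symm
    _ ≤ b + b := add_le_add h1 h1
    _ = 2 * b := (two_mul b).symm

/-- One step of the stopping argument. The points `z` of the box over `T(w)` for which the set
where the counting function `G` exceeds the level `l` fills less than half of `T(z)` are controlled
by `l`; the tents of the remaining points lie in a small set, to which the Carleson constant `K`
applies. -/
theorem measure_box_le_of_level {W : Measure Torus} [IsFiniteMeasure W] {D : ℝ≥0}
    (hD : Doubling W D) {m : Measure Disk} [SFinite m] {K : ℝ≥0∞} {t : ℝ} (ht : 1 ≤ t)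
    (hτ : ∀ w, (m.withDensity fun z => W (Tent z)) (box (Tent w)) ≤ K * W (Tent w) ^ t)
    (w : Disk) (l : ℝ≥0∞) :
    (m.withDensity fun z => W (Tent z)) (box (Tent w)) ≤ 2 * l * W (Tent w) +
      K * (D : ℝ≥0∞) ^ t *
        (2 * D * W {ξ | l < area m ((box (Tent w)).indicator 1) ξ}) ^ t := by
  set B := box (Tent w)
  have hB : MeasurableSet B := (isClosed_box _).measurableSet
  have hB1 : Measurable (B.indicator (1 : Disk → ℝ≥0∞)) := measurable_one.indicator hB
  set G := area m (B.indicator 1)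
  have hG : Measurable G := measurable_area m hB1
  set E := {ξ | l < G ξ}
  have hE : MeasurableSet E := measurableSet_lt measurable_const hG
  set τ := m.withDensity fun z => W (Tent z)
  set U := {ξ | 1 / 2 < ntSup (tentAvg W (E.indicator 1)) ξ}
  have hWU : W U ≤ 2 * D * W E := by
    have h := mul_measure_ntSup_tentAvg_le hD (E.indicator 1) (1 / 2)
    rw [lintegral_indicator_one hE] at h
    calc W U = 2 * (1 / 2 * W U) := by
          rw [← mul_assoc, one_div, ENNReal.mul_inv_cancel (by simp) (by simp), one_mul]
      _ ≤ 2 * (D * W E) := by gcongr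
      _ = _ := by ring
  -- the bad points
  have hbad : τ (box U) ≤ K * (D : ℝ≥0∞) ^ t * (2 * D * W E) ^ t := by
    refine (measure_box_le hD ht hτ U).trans ?_
    have : 0 ≤ t := by linarith
    gcongr
  -- the good points
  have hpt : ∀ z ∈ B \ box U, W (Tent z) ≤ 2 * ∫⁻ ξ in Tent z, Eᶜ.indicator 1 ξ ∂W := by
    rintro z ⟨-, hz⟩
    have h1 : tentAvg W (E.indicator 1) z ≤ 1 / 2 := by
      by_contra hcon
      exact hz fun ξ hξ => (not_le.1 hcon).trans_le (le_ntSup _ hξ)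
    have h2 : W (Tent z ∩ E) ≤ W (Tent z) / 2 := by
      rw [tentAvg, lintegral_indicator_one hE, Measure.restrict_apply hE, inter_comm] at h1
      by_cases hz0 : W (Tent z) = 0
      · exact (measure_mono inter_subset_left).trans (by rw [hz0]; exact zero_le)
      rw [ENNReal.div_le_iff hz0 (measure_ne_top _ _)] at h1
      rwa [one_div, mul_comm, ← div_eq_mul_inv] at h1
    rw [lintegral_indicator_one hE.compl, Measure.restrict_apply hE.compl, inter_comm,
      ← sdiff_eq]
    refine sub_half_le (measure_ne_top _ _) ?_
    calc W (Tent z) = W (Tent z \ E) + W (Tent z ∩ E) := by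
          rw [add_comm, measure_inter_add_sdiff _ hE]
      _ ≤ _ := by gcongr
  have hgood : τ (B \ box U) ≤ 2 * l * W (Tent w) := by
    rw [withDensity_apply _ (hB.diff (isClosed_box U).measurableSet)]
    calc _ ≤ ∫⁻ z in B \ box U, 2 * ∫⁻ ξ in Tent z, Eᶜ.indicator 1 ξ ∂W ∂m :=
          setLIntegral_mono' (hB.diff (isClosed_box U).measurableSet) hpt
      _ ≤ ∫⁻ z in B, 2 * ∫⁻ ξ in Tent z, Eᶜ.indicator 1 ξ ∂W ∂m :=
          lintegral_mono_set sdiff_subset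
      _ = 2 * ∫⁻ z, B.indicator 1 z * ∫⁻ ξ in Tent z, Eᶜ.indicator 1 ξ ∂W ∂m := by
          rw [lintegral_const_mul' _ _ (by simp), ← lintegral_indicator hB]
          congr 1
          refine lintegral_congr fun z => ?_
          by_cases hz : z ∈ B
          · rw [indicator_of_mem hz, indicator_of_mem hz, Pi.one_apply, one_mul]
          · rw [indicator_of_notMem hz, indicator_of_notMem hz, zero_mul]
      _ = 2 * ∫⁻ ξ, G ξ * Eᶜ.indicator 1 ξ ∂W := by
          rw [lintegral_area_mul m W hB1 (measurable_one.indicator hE.compl)]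
      _ ≤ 2 * ∫⁻ ξ, (Tent w).indicator (fun _ => l) ξ ∂W := by
          gcongr with ξ
          by_cases hξ : ξ ∈ Tent w
          · rw [indicator_of_mem hξ]
            by_cases hξE : ξ ∈ E
            · rw [indicator_of_notMem (by simpa using hξE), mul_zero]; exact zero_le
            · rw [indicator_of_mem (by exact hξE), Pi.one_apply, mul_one]
              exact not_lt.1 hξE
          · have : G ξ = 0 := area_indicator_eq_zero hξ
            rw [this, zero_mul]; exact zero_le
      _ = _ := by
          rw [lintegral_indicator_const (measurableSet_tent w), mul_assoc]
  calc τ B ≤ τ ((B \ box U) ∪ box U) :=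
        measure_mono (by rw [sdiff_union_self]; exact subset_union_left)
    _ ≤ _ := (measure_union_le _ _).trans (add_le_add hgood hbad)

/-- On a compact disk the Carleson constant is automatically finite, because `z ↦ W(T(z))` has a
positive minimum there. -/
theorem exists_carleson_restrict {W : Measure Torus} [IsFiniteMeasure W]
    (hW : ∀ z, W (Tent z) ≠ 0) (m : Measure Disk) [IsLocallyFiniteMeasure m] {t : ℝ} (ht : 0 ≤ t)
    {ρ : ℝ} (hρ : ρ < 1) : ∃ K : ℝ≥0∞, K ≠ ∞ ∧ ∀ w,
      ((m.restrict (closedDisk ρ)).withDensity fun z => W (Tent z)) (box (Tent w)) ≤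
        K * W (Tent w) ^ t := by
  have hc := isCompact_closedDisk hρ
  rcases (closedDisk ρ).eq_empty_or_nonempty with he | hne
  · exact ⟨0, by simp, fun w => by simp [he]⟩
  obtain ⟨z₀, -, hz₀⟩ := (lowerSemicontinuous_measure_tent W).lowerSemicontinuousOn
    (closedDisk ρ) |>.exists_isMinOn hne hc
  have hc0 : W (Tent z₀) ^ t ≠ 0 := by
    simp [ENNReal.rpow_eq_zero_iff, hW z₀, measure_ne_top]
  have hct : W (Tent z₀) ^ t ≠ ∞ := ENNReal.rpow_ne_top_of_nonneg ht (measure_ne_top _ _)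
  refine ⟨W univ * m (closedDisk ρ) / W (Tent z₀) ^ t, ENNReal.div_ne_top
    (ENNReal.mul_ne_top (measure_ne_top _ _) hc.measure_lt_top.ne) hc0, fun w => ?_⟩
  have hB : MeasurableSet (box (Tent w)) := (isClosed_box _).measurableSet
  rw [withDensity_apply _ hB, Measure.restrict_restrict hB]
  rcases (box (Tent w) ∩ closedDisk ρ).eq_empty_or_nonempty with he | ⟨z, hz, hzρ⟩
  · rw [he]; simp
  have hle : W (Tent z₀) ≤ W (Tent w) := (hz₀ hzρ).trans (measure_mono hz)
  calc _ ≤ ∫⁻ _ in box (Tent w) ∩ closedDisk ρ, W univ ∂m :=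
        lintegral_mono fun z => measure_mono (subset_univ _)
    _ = W univ * m (box (Tent w) ∩ closedDisk ρ) := setLIntegral_const _ _
    _ ≤ W univ * m (closedDisk ρ) := mul_le_mul' le_rfl (measure_mono inter_subset_right)
    _ = W univ * m (closedDisk ρ) / W (Tent z₀) ^ t * W (Tent z₀) ^ t :=
        (ENNReal.div_mul_cancel hc0 hct).symm
    _ ≤ _ := by gcongr

/-- If the area function of the box over each tent `T(w)` has `q`-th power integral at most
`C W(T(w)) ^ (q/p)`, then the Carleson condition holds with a constant which depends on `C`, `D` and
`q` only, provided that some finite constant is known to work. -/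
theorem carleson_le_of_area_le {W : Measure Torus} [IsFiniteMeasure W] {D : ℝ≥0}
    (hD : Doubling W D) (hW : ∀ z, W (Tent z) ≠ 0) {m : Measure Disk} [SFinite m] {p q t : ℝ}
    (hp : 0 < p) (hpq : p ≤ q) (ht : t = 1 + 1 / p - 1 / q) {C : ℝ≥0}
    (h : ∀ w, ∫⁻ ξ, area m ((box (Tent w)).indicator 1) ξ ^ q ∂W ≤ C * W (Tent w) ^ (q / p))
    {K : ℝ≥0∞} (hK : K ≠ ∞)
    (hτ : ∀ w, (m.withDensity fun z => W (Tent z)) (box (Tent w)) ≤ K * W (Tent w) ^ t) (w : Disk) :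
    (m.withDensity fun z => W (Tent z)) (box (Tent w)) ≤
      4 * ((4 * D ^ 2 * C + 1 : ℝ≥0) : ℝ≥0∞) ^ (1 / q) * W (Tent w) ^ t := by
  have hq : 0 < q := hp.trans_le hpq
  have ht1 : 1 ≤ t := by
    have := one_div_le_one_div_of_le hp hpq; linarith
  have ht0 : 0 ≤ t := by linarith
  set τ := m.withDensity fun z => W (Tent z)
  set N : ℝ≥0∞ := ((4 * D ^ 2 * C + 1 : ℝ≥0) : ℝ≥0∞) with hN
  -- `N` is chosen so that `D * (2 * D * W E) ≤ W (Tent w) / 2` for the set `E` below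
  have hN0 : N ≠ 0 := by rw [hN]; positivity
  have hNt : N ≠ ∞ := ENNReal.coe_ne_top
  -- the best constant is finite, and it satisfies `κ ≤ 2 N ^ (1/q) + κ / 2`
  set κ : ℝ≥0∞ := ⨆ w, τ (box (Tent w)) / W (Tent w) ^ t with hκ
  have hx0 (w : Disk) : W (Tent w) ^ t ≠ 0 := by
    simp [ENNReal.rpow_eq_zero_iff, hW w, measure_ne_top]
  have hxt (w : Disk) : W (Tent w) ^ t ≠ ∞ := ENNReal.rpow_ne_top_of_nonneg ht0 (measure_ne_top _ _)
  have hκt : κ ≠ ∞ := ne_top_of_le_ne_top hK (iSup_le fun w =>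
    (ENNReal.div_le_iff (hx0 w) (hxt w)).2 (hτ w))
  have hκτ (w : Disk) : τ (box (Tent w)) ≤ κ * W (Tent w) ^ t :=
    (ENNReal.div_le_iff (hx0 w) (hxt w)).1 (le_iSup (fun w => τ (box (Tent w)) / W (Tent w) ^ t) w)
  have key : κ ≤ 2 * N ^ (1 / q) + κ / 2 := by
    refine iSup_le fun w => (ENNReal.div_le_iff (hx0 w) (hxt w)).2 ?_
    set x := W (Tent w)
    have hx : x ≠ 0 := hW w
    have hx' : x ≠ ∞ := measure_ne_top _ _
    set l : ℝ≥0∞ := N ^ (1 / q) * x ^ (1 / p - 1 / q)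
    refine (measure_box_le_of_level hD ht1 hκτ w l).trans ?_
    set E := {ξ | l < area m ((box (Tent w)).indicator 1) ξ}
    -- Chebyshev's inequality at the level `l`
    have hE : N * W E ≤ C * x := by
      have hlq : l ^ q = N * x ^ (q / p - 1) := by
        rw [ENNReal.mul_rpow_of_nonneg _ _ hq.le, ← ENNReal.rpow_mul, ← ENNReal.rpow_mul,
          one_div_mul_cancel hq.ne', ENNReal.rpow_one]
        congr 2
        field_simp
      have h1 : l ^ q * W E ≤ C * x ^ (q / p) := by
        refine le_trans ?_ (h w)
        refine le_trans ?_ (mul_meas_ge_le_lintegral₀ (Measurable.aemeasurable ?_) (l ^ q))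
        · exact mul_le_mul' le_rfl (measure_mono fun ξ (hξ : l < _) =>
            ENNReal.rpow_le_rpow hξ.le hq.le)
        · exact (measurable_area m
            (measurable_one.indicator (isClosed_box _).measurableSet)).pow_const _
      have hxe : x ^ (q / p) = x ^ (q / p - 1) * x := by
        conv_lhs => rw [← sub_add_cancel (q / p) 1, ENNReal.rpow_add _ _ hx hx', ENNReal.rpow_one]
      have hy0 : x ^ (q / p - 1) ≠ 0 := by simp [ENNReal.rpow_eq_zero_iff, hx, hx']
      have hyt : x ^ (q / p - 1) ≠ ∞ := by simp [ENNReal.rpow_eq_top_iff, hx, hx']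
      rw [hlq, hxe] at h1
      refine (ENNReal.mul_le_mul_iff_right hy0 hyt).1 ?_
      calc _ = N * x ^ (q / p - 1) * W E := by ring
        _ ≤ _ := h1
        _ = _ := by ring
    have hE' : D * (2 * D * W E) ≤ x * 2⁻¹ := by
      refine (ENNReal.mul_le_mul_iff_right hN0 hNt).1 ?_
      calc N * (D * (2 * D * W E)) = 2 * D ^ 2 * (N * W E) := by ring
        _ ≤ 2 * D ^ 2 * (C * x) := by gcongr
        _ = (2 * 2⁻¹) * (2 * D ^ 2 * (C * x)) := by
            rw [ENNReal.mul_inv_cancel (by simp) (by simp), one_mul]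
        _ = 4 * D ^ 2 * C * (x * 2⁻¹) := by ring
        _ ≤ N * (x * 2⁻¹) := by
            gcongr
            rw [hN]; push_cast; exact le_self_add
    have e1 : 2 * l * x = 2 * N ^ (1 / q) * x ^ t := by
      have : x ^ t = x ^ (1 / p - 1 / q) * x := by
        conv_rhs => rw [← ENNReal.rpow_one x, ← ENNReal.rpow_mul, one_mul,
          ← ENNReal.rpow_add _ _ hx hx']
        congr 1; rw [ht]; ring
      rw [this]; simp only [l]; ring
    have e2 : (D : ℝ≥0∞) ^ t * (2 * D * W E) ^ t ≤ 2⁻¹ * x ^ t := by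
      rw [← ENNReal.mul_rpow_of_nonneg _ _ ht0]
      calc _ ≤ (x * 2⁻¹) ^ t := by gcongr
        _ = (2⁻¹ : ℝ≥0∞) ^ t * x ^ t := by rw [ENNReal.mul_rpow_of_nonneg _ _ ht0, mul_comm]
        _ ≤ _ := by
            gcongr
            exact ENNReal.rpow_le_self_of_le_one (by simp) ht1
    calc _ = 2 * N ^ (1 / q) * x ^ t + κ * ((D : ℝ≥0∞) ^ t * (2 * D * W E) ^ t) := by
          rw [e1, mul_assoc κ]
      _ ≤ 2 * N ^ (1 / q) * x ^ t + κ * (2⁻¹ * x ^ t) := by gcongr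
      _ = _ := by rw [div_eq_mul_inv κ]; ring
  calc _ ≤ κ * W (Tent w) ^ t := hκτ w
    _ ≤ 2 * (2 * N ^ (1 / q)) * W (Tent w) ^ t := by
        gcongr; exact sub_half_le hκt key
    _ = _ := by ring

/-- The Carleson condition follows from the testing inequality for the area function of boxes. -/
theorem carleson_of_area_le {W : Measure Torus} [IsFiniteMeasure W] {D : ℝ≥0}
    (hD : Doubling W D) (hW : ∀ z, W (Tent z) ≠ 0) {m : Measure Disk} {p q t : ℝ}
    (hp : 0 < p) (hpq : p ≤ q) (ht : t = 1 + 1 / p - 1 / q) {C : ℝ≥0}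
    (h : ∀ w, ∫⁻ ξ, area m ((box (Tent w)).indicator 1) ξ ^ q ∂W ≤ C * W (Tent w) ^ (q / p)) :
    ∃ K : ℝ≥0, ∀ w,
      (m.withDensity fun z => W (Tent z)) (box (Tent w)) ≤ K * W (Tent w) ^ t := by
  have hq : 0 < q := hp.trans_le hpq
  have ht0 : 0 ≤ t := by
    have := one_div_le_one_div_of_le hp hpq; linarith
  -- the box over `T(0)` is the whole disk, so the area function of the disk is in `L^q(W)`
  have : IsLocallyFiniteMeasure m := by
    have h0 := h 0
    have e : box (Tent (0 : Disk)) = univ := by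
      rw [tent_zero]; exact eq_univ_of_forall fun z => subset_univ _
    have e' (ξ : Torus) : area m 1 ξ = m {z | ξ ∈ Tent z} := setLIntegral_one _
    rw [e, indicator_univ] at h0
    simp only [e'] at h0
    exact isLocallyFiniteMeasure_of_lintegral hW hq (ne_top_of_le_ne_top (ENNReal.mul_ne_top
      ENNReal.coe_ne_top (ENNReal.rpow_ne_top_of_nonneg (by positivity) (measure_ne_top _ _))) h0)
  set τ := m.withDensity fun z => W (Tent z)
  set N : ℝ≥0∞ := ((4 * D ^ 2 * C + 1 : ℝ≥0) : ℝ≥0∞)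
  have hK : 4 * N ^ (1 / q) ≠ ∞ := ENNReal.mul_ne_top (by simp)
    (ENNReal.rpow_ne_top_of_nonneg (by positivity) ENNReal.coe_ne_top)
  refine ⟨(4 * N ^ (1 / q)).toNNReal, fun w => ?_⟩
  rw [ENNReal.coe_toNNReal hK]
  set ρ : ℕ → ℝ := fun n => 1 - 1 / ((n : ℝ) + 1)
  have hρ (n : ℕ) : ρ n < 1 := by
    have : (0 : ℝ) < 1 / ((n : ℝ) + 1) := by positivity
    simp only [ρ]; linarith
  have hmono : Monotone fun n => box (Tent w) ∩ closedDisk (ρ n) := by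
    intro a b hab
    refine inter_subset_inter_right _ fun z (hz : ‖(z : ℂ)‖ ≤ ρ a) => ?_
    refine le_trans hz ?_
    simp only [ρ]
    gcongr
  have hU : box (Tent w) = ⋃ n, box (Tent w) ∩ closedDisk (ρ n) := by
    rw [← inter_iUnion, eq_comm, inter_eq_left]
    intro z _
    obtain ⟨n, hn⟩ := exists_nat_one_div_lt (sub_pos.2 (norm_disk_lt z))
    refine mem_iUnion.2 ⟨n, ?_⟩
    change ‖(z : ℂ)‖ ≤ 1 - 1 / ((n : ℝ) + 1)
    linarith
  rw [hU, hmono.measure_iUnion]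
  refine iSup_le fun n => ?_
  have hcl := (isCompact_closedDisk (hρ n)).measurableSet
  have : IsFiniteMeasure (m.restrict (closedDisk (ρ n))) :=
    ⟨by rw [Measure.restrict_apply_univ]; exact (isCompact_closedDisk (hρ n)).measure_lt_top⟩
  obtain ⟨K, hK, hKτ⟩ := exists_carleson_restrict hW m ht0 (hρ n)
  have hn := carleson_le_of_area_le hD hW hp hpq ht (C := C)
    (fun w => (lintegral_mono fun ξ => ?_).trans (h w)) hK hKτ w
  · rwa [← restrict_withDensity hcl, Measure.restrict_apply (isClosed_box _).measurableSet] at hn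
  · refine ENNReal.rpow_le_rpow ?_ hq.le
    exact lintegral_mono' (Measure.restrict_mono le_rfl Measure.restrict_le_self) le_rfl

/-! ### Necessity of the Carleson condition: test functions -/

/-- The test function `z ↦ ((1 - |a|) / (1 - ā z)) ^ k`, which is bounded by `1` on the closed disk
and comparable to `1` on the box over `T(a)`. -/
def testFun (a : ℂ) (k : ℕ) (z : ℂ) : ℂ :=
  (((1 - ‖a‖ : ℝ) : ℂ) / (1 - (starRingEnd ℂ) a * z)) ^ k

theorem le_norm_one_sub_conj_mul {a z : ℂ} (hz : ‖z‖ ≤ 1) :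
    1 - ‖a‖ ≤ ‖1 - (starRingEnd ℂ) a * z‖ := by
  have h := norm_sub_norm_le 1 ((starRingEnd ℂ) a * z)
  rw [norm_one, norm_mul, Complex.norm_conj] at h
  nlinarith [norm_nonneg a]

theorem norm_one_sub_conj_mul (a : ℂ) (ξ : Torus) :
    ‖1 - (starRingEnd ℂ) a * ξ‖ = ‖(ξ : ℂ) - a‖ := by
  have h : (starRingEnd ℂ) ((ξ : ℂ) - a) * ξ = 1 - (starRingEnd ℂ) a * ξ := by
    rw [map_sub, sub_mul, ← Complex.normSq_eq_conj_mul_self, Complex.normSq_eq_norm_sq,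
      norm_torus]
    simp
  rw [← h, norm_mul, norm_torus, mul_one, Complex.norm_conj]

theorem norm_testFun {a : ℂ} (ha : ‖a‖ < 1) (k : ℕ) (z : ℂ) :
    ‖testFun a k z‖ = ((1 - ‖a‖) / ‖1 - (starRingEnd ℂ) a * z‖) ^ k := by
  rw [testFun, norm_pow, norm_div, Complex.norm_real, Real.norm_of_nonneg (by linarith)]

theorem norm_testFun_le {a : ℂ} (ha : ‖a‖ < 1) (k : ℕ) {z : ℂ} (hz : ‖z‖ ≤ 1) :
    ‖testFun a k z‖ ≤ 1 := by
  rw [norm_testFun ha]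
  refine pow_le_one₀ (div_nonneg (by linarith) (norm_nonneg _))
    (div_le_one_of_le₀ ?_ (norm_nonneg _))
  exact le_norm_one_sub_conj_mul hz

theorem differentiableAt_testFun {a : ℂ} (ha : ‖a‖ < 1) (k : ℕ) {z : ℂ} (hz : ‖z‖ ≤ 1) :
    DifferentiableAt ℂ (testFun a k) z := by
  have h : 1 - (starRingEnd ℂ) a * z ≠ 0 := by
    refine norm_pos_iff.1 (lt_of_lt_of_le ?_ (le_norm_one_sub_conj_mul hz))
    linarith
  unfold testFun
  fun_prop (disch := exact h)

theorem memH1_testFun {a : ℂ} (ha : ‖a‖ < 1) (k : ℕ) : MemH1 (testFun a k) := by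
  refine ⟨fun z hz => (differentiableAt_testFun ha k
    (mem_ball_zero_iff.1 hz).le).differentiableWithinAt, ?_⟩
  refine lt_of_le_of_lt (b := (ENNReal.ofReal (2 * Real.pi))⁻¹ * arcLength univ)
    (iSup₂_le fun r hr => ?_) ?_
  · gcongr
    rw [← lintegral_one]
    refine lintegral_mono fun ξ => ?_
    have : ‖(r : ℂ) * ξ‖ ≤ 1 := by
      rw [norm_mul, norm_torus, mul_one, Complex.norm_real, Real.norm_of_nonneg hr.1.le]
      exact hr.2.le
    rw [← ofReal_norm, ENNReal.ofReal_le_one]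
    exact norm_testFun_le ha k this
  · exact ENNReal.mul_lt_top (ENNReal.inv_lt_top.2 (ENNReal.ofReal_pos.2 (by positivity)))
      (measure_lt_top _ _)

theorem isBoundaryFunction_testFun {a : ℂ} (ha : ‖a‖ < 1) (k : ℕ) :
    IsBoundaryFunction (testFun a k) fun ξ => testFun a k ξ :=
  ae_of_all _ fun ξ => ((differentiableAt_testFun ha k
    (norm_torus ξ).le).continuousAt).tendsto.mono_left nhdsWithin_le_nhds

/-- On the circle, a high power of the test function is dominated by the Poisson kernel. -/
theorem enorm_testFun_rpow_le {a : ℂ} (ha : ‖a‖ < 1) {k : ℕ} {p : ℝ} (hp : 0 < p)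
    (hk : 2 ≤ k * p) (ξ : Torus) :
    ‖testFun a k ξ‖ₑ ^ p ≤ ENNReal.ofReal (1 - ‖a‖) * pk a ξ := by
  have h1 : 0 < 1 - ‖a‖ := by linarith
  have h2 := one_sub_norm_le a ξ
  have h3 : 0 < ‖(ξ : ℂ) - a‖ := h1.trans_le h2
  rw [pk, poissonKernel_def, sub_zero, sub_zero, norm_torus, ← ofReal_norm,
    ENNReal.ofReal_rpow_of_nonneg (norm_nonneg _) hp.le, ← ENNReal.ofReal_mul h1.le]
  refine ENNReal.ofReal_le_ofReal ?_
  rw [norm_testFun ha, norm_one_sub_conj_mul]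
  set b := (1 - ‖a‖) / ‖(ξ : ℂ) - a‖
  have hb0 : 0 < b := by positivity
  have hb1 : b ≤ 1 := (div_le_one h3).2 h2
  calc (b ^ k) ^ p = b ^ (k * p) := by rw [Real.rpow_natCast_mul hb0.le]
    _ ≤ b ^ (2 : ℝ) := Real.rpow_le_rpow_of_exponent_ge hb0 hb1 hk
    _ = (1 - ‖a‖) * (1 - ‖a‖) / ‖(ξ : ℂ) - a‖ ^ 2 := by
        rw [Real.rpow_two, div_pow, sq (1 - ‖a‖)]
    _ ≤ _ := by
        rw [mul_div_assoc]
        have : 1 - ‖a‖ ≤ 1 ^ 2 - ‖a‖ ^ 2 := by nlinarith [norm_nonneg a]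
        gcongr

/-- For `ξ ∈ T(z) ⊆ T(a)` the denominator `|1 - ā z|` is at most
`|ξ - a| + |ξ - z| < (2 + 10) (1 - |a|)`. -/
theorem le_norm_testFun (a : Disk) (k : ℕ) {z : Disk} (hz : z ∈ box (Tent a)) :
    (1 / 12 : ℝ) ^ k ≤ ‖testFun a k z‖ := by
  have ha := norm_disk_lt a
  have h1 : 0 < 1 - ‖(a : ℂ)‖ := by linarith
  obtain ⟨η, hη⟩ := exists_radial_eq a
  have hz1 : 1 - ‖(z : ℂ)‖ ≤ 5 * (1 - ‖(a : ℂ)‖) := by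
    refine one_sub_norm_le_of_tent_subset (η := η) h1 ?_
    rw [hη]; exact hz
  obtain ⟨ξ, hξ⟩ := tent_nonempty z
  have hξa := mem_tent.1 (hz hξ)
  have hξz := mem_tent.1 hξ
  rw [norm_testFun ha]
  refine pow_le_pow_left₀ (by norm_num) ?_ k
  have h2 : 0 < ‖1 - (starRingEnd ℂ) (a : ℂ) * z‖ :=
    h1.trans_le (le_norm_one_sub_conj_mul (norm_disk_lt z).le)
  rw [div_le_div_iff₀ (by norm_num) h2, one_mul]
  have h3 : ‖1 - (starRingEnd ℂ) (a : ℂ) * z‖ ≤ ‖(ξ : ℂ) - a‖ + ‖(ξ : ℂ) - z‖ := by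
    calc _ = ‖(1 - (starRingEnd ℂ) (a : ℂ) * ξ) + (starRingEnd ℂ) (a : ℂ) * (ξ - z)‖ := by
          congr 1; ring
      _ ≤ _ := norm_add_le _ _
      _ ≤ _ := by
          rw [norm_one_sub_conj_mul, norm_mul, Complex.norm_conj]
          gcongr
          exact mul_le_of_le_one_left (norm_nonneg _) ha.le
  linarith

/-- The norm of the test function at `a` in `H^p(ω)` is controlled by `ω(T(a)) ^ (1/p)`. -/
theorem IsA1.exists_lintegral_testFun_le {ω : Torus → ℝ≥0} (hω : AEMeasurable ω arcLength)
    (hA : IsA1 ω) {k : ℕ} {p : ℝ} (hp : 0 < p) (hk : 2 ≤ k * p) :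
    ∃ C : ℝ≥0, ∀ a : Disk,
      ∫⁻ ξ : Torus, ‖testFun a k ξ‖ₑ ^ p ∂weighted ω ≤ C * weighted ω (Tent a) := by
  obtain ⟨C, hC⟩ := hA.weighted_mul_le
  refine ⟨64 * (3 * C), fun a => ?_⟩
  have ha := norm_disk_lt a
  obtain ⟨η, hη⟩ := exists_radial_eq a
  set d := 1 - ‖(a : ℂ)‖
  have hd : 0 < d := by simp only [d]; linarith
  have hd1 : d ≤ 1 := by simp only [d]; linarith [norm_nonneg (a : ℂ)]
  have hd0 : ENNReal.ofReal d ≠ 0 := (ENNReal.ofReal_pos.2 hd).ne'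
  have hω' : AEMeasurable (fun ξ => (ω ξ : ℝ≥0∞)) arcLength := hω.coe_nnreal_ennreal
  have h := lintegral_pk_le hω' η hd hd1
    (S := 3 * C * weighted ω (Tent a) / ENNReal.ofReal d) (fun D hD => ?_)
  · rw [weighted, lintegral_withDensity_eq_lintegral_mul₀ hω']
    · calc _ ≤ ∫⁻ ξ, ENNReal.ofReal d * (pk a ξ * ω ξ) ∂arcLength := by
            refine lintegral_mono fun ξ => ?_
            rw [Pi.mul_apply, mul_comm, ← mul_assoc]
            gcongr
            exact enorm_testFun_rpow_le ha hp hk ξ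
        _ = ENNReal.ofReal d * ∫⁻ ξ, pk a ξ * ω ξ ∂arcLength :=
            lintegral_const_mul' _ _ ENNReal.ofReal_ne_top
        _ ≤ ENNReal.ofReal d * (64 * (3 * C * weighted ω (Tent a) / ENNReal.ofReal d)) := by
            rw [hη] at h; gcongr
        _ = 64 * (ENNReal.ofReal d * (3 * C * weighted ω (Tent a) / ENNReal.ofReal d)) := by ring
        _ = _ := by
            rw [ENNReal.mul_div_cancel hd0 ENNReal.ofReal_ne_top, weighted]
            push_cast; ring
    · refine ((Continuous.measurable ?_).enorm.pow_const p).aemeasurable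
      refine continuous_iff_continuousAt.2 fun ξ => ?_
      exact (differentiableAt_testFun ha k (norm_torus ξ).le).continuousAt.comp
        continuous_subtype_val.continuousAt
  · have hD0 : 0 < D := hd.trans_le hD
    have e : ∫⁻ ξ in Tent (radial η D), (ω ξ : ℝ≥0∞) ∂arcLength =
        weighted ω (Tent (radial η D)) := by
      rw [weighted, withDensity_apply _ (measurableSet_tent _)]
    rw [e, ← mul_div_assoc, ENNReal.le_div_iff_mul_le (.inl hd0) (.inl ENNReal.ofReal_ne_top)]
    have hle : ENNReal.ofReal d ≤ arcLength (Metric.ball η d) :=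
      (ENNReal.ofReal_le_ofReal (by linarith)).trans
        (le_arcLength_ball η (by linarith [Real.pi_gt_three]))
    have hball : Metric.ball η d ⊆ Metric.ball η (3 * D) := Metric.ball_subset_ball (by linarith)
    calc _ ≤ weighted ω (Metric.ball η (3 * D)) * arcLength (Metric.ball η d) :=
          mul_le_mul' (measure_mono (tent_subset_ball η hD0)) hle
      _ ≤ C * ENNReal.ofReal (3 * D) * weighted ω (Metric.ball η d) :=
          hC η _ (by positivity) _ hball
      _ ≤ C * ENNReal.ofReal (3 * D) * weighted ω (Tent a) := by
          rw [← hη]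
          exact mul_le_mul' le_rfl (measure_mono (ball_subset_tent η hd))
      _ = _ := by
          rw [ENNReal.ofReal_mul (by norm_num), ENNReal.ofReal_ofNat]; ring

/-- Boundedness of the area operator, tested on the functions `testFun a k`. -/
theorem AreaOpBounded.exists_lintegral_area_le {μ : Measure Disk} {ν : Measure Torus}
    {ω : Torus → ℝ≥0} (hω : AEMeasurable ω arcLength) (hA : IsA1 ω) {p q : ℝ} (hp : 0 < p)
    (hq : 0 < q) (h : AreaOpBounded μ ν ω p q) : ∃ C : ℝ≥0, ∀ a : Disk,
      ∫⁻ ξ, area (reduced μ ν) ((box (Tent a)).indicator 1) ξ ^ q ∂weighted ω ≤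
        C * weighted ω (Tent a) ^ (q / p) := by
  have := hA.isFiniteMeasure
  -- the exponent makes `|testFun a k| ^ p` decay at least as fast as the Poisson kernel
  obtain ⟨k, hk⟩ : ∃ k : ℕ, 2 ≤ k * p := by
    obtain ⟨k, hk⟩ := exists_nat_ge (2 / p)
    exact ⟨k, (div_le_iff₀ hp).1 hk⟩
  obtain ⟨C, hC⟩ := hA.exists_lintegral_testFun_le hω hp hk
  obtain ⟨M, -, hM⟩ := h
  set c := (ENNReal.ofReal (2 * Real.pi))⁻¹ with hc
  have hc0 : c ≠ 0 := ENNReal.inv_ne_zero.2 ENNReal.ofReal_ne_top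
  have hc1 : c ≠ ∞ := by
    refine ENNReal.inv_ne_top.2 ?_
    simp [Real.pi_pos]
  have hqp : 0 ≤ q / p := by positivity
  set L : ℝ≥0∞ := ((12 : ℝ≥0∞) ^ k) ^ q * (c⁻¹ * ((M : ℝ≥0∞) ^ q * (c * C) ^ (q / p)))
  have hL : L ≠ ∞ := by
    refine ENNReal.mul_ne_top (ENNReal.rpow_ne_top_of_nonneg hq.le (by finiteness))
      (ENNReal.mul_ne_top (ENNReal.inv_ne_top.2 hc0) (ENNReal.mul_ne_top
      (ENNReal.rpow_ne_top_of_nonneg hq.le ENNReal.coe_ne_top)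
      (ENNReal.rpow_ne_top_of_nonneg hqp (ENNReal.mul_ne_top hc1 ENNReal.coe_ne_top))))
  refine ⟨L.toNNReal, fun a => ?_⟩
  rw [ENNReal.coe_toNNReal hL]
  have ha := norm_disk_lt a
  have hf := memH1_testFun ha k
  set Y := ∫⁻ ξ : Torus, ‖testFun a k ξ‖ₑ ^ p ∂weighted ω
  set X := ∫⁻ ξ, area (reduced μ ν) (fun z => ‖testFun a k z‖ₑ) ξ ^ q ∂weighted ω
  have hY : Y ≤ C * weighted ω (Tent a) := hC a
  have hbd := hM _ _ ⟨hf, isBoundaryFunction_testFun ha k, by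
    rw [wNorm_eq hω]
    exact ENNReal.rpow_lt_top_of_nonneg (by positivity) (ENNReal.mul_ne_top hc1
      (ne_top_of_le_ne_top (ENNReal.mul_ne_top ENNReal.coe_ne_top (measure_ne_top _ _)) hY))⟩
  rw [wNorm_eq hω, wNorm_eq hω, areaOp_eq_area μ ν (measurable_enorm_disk hf.1)] at hbd
  have hX : X ≤ c⁻¹ * ((M : ℝ≥0∞) ^ q * (c * C) ^ (q / p)) * weighted ω (Tent a) ^ (q / p) := by
    have h1 := ENNReal.rpow_le_rpow hbd hq.le
    rw [← ENNReal.rpow_mul, one_div_mul_cancel hq.ne', ENNReal.rpow_one,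
      ENNReal.mul_rpow_of_nonneg _ _ hq.le, ← ENNReal.rpow_mul, one_div_mul_eq_div] at h1
    calc X = c⁻¹ * (c * X) := by rw [← mul_assoc, ENNReal.inv_mul_cancel hc0 hc1, one_mul]
      _ ≤ c⁻¹ * ((M : ℝ≥0∞) ^ q * (c * Y) ^ (q / p)) := by gcongr
      _ ≤ c⁻¹ * ((M : ℝ≥0∞) ^ q * (c * (C * weighted ω (Tent a))) ^ (q / p)) := by gcongr
      _ = _ := by
          rw [← mul_assoc c, ENNReal.mul_rpow_of_nonneg _ _ hqp]; ring
  have hle (ξ : Torus) : area (reduced μ ν) ((box (Tent a)).indicator 1) ξ ≤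
      12 ^ k * area (reduced μ ν) (fun z => ‖testFun a k z‖ₑ) ξ := by
    rw [area, area, ← lintegral_const_mul' _ _ (by finiteness)]
    refine lintegral_mono fun z => ?_
    by_cases hz : z ∈ box (Tent a)
    · rw [indicator_of_mem hz, Pi.one_apply]
      have h1 := le_norm_testFun a k hz
      have h2 : 1 ≤ 12 ^ k * ‖testFun a k z‖ := by
        rw [one_div, inv_pow] at h1
        exact (inv_le_iff_one_le_mul₀' (by positivity)).1 h1
      have h3 := ENNReal.ofReal_le_ofReal h2
      rw [ENNReal.ofReal_one, ENNReal.ofReal_mul (by positivity), ENNReal.ofReal_pow (by norm_num),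
        ofReal_norm] at h3
      simpa using h3
    · rw [indicator_of_notMem hz]; exact zero_le
  calc _ ≤ ∫⁻ ξ, ((12 : ℝ≥0∞) ^ k) ^ q *
          area (reduced μ ν) (fun z => ‖testFun a k z‖ₑ) ξ ^ q ∂weighted ω := by
        refine lintegral_mono fun ξ => ?_
        rw [← ENNReal.mul_rpow_of_nonneg _ _ hq.le]
        exact ENNReal.rpow_le_rpow (hle ξ) hq.le
    _ = ((12 : ℝ≥0∞) ^ k) ^ q * X :=
        lintegral_const_mul' _ _ (ENNReal.rpow_ne_top_of_nonneg hq.le (by finiteness))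
    _ ≤ _ := by
        simp only [L]; rw [mul_assoc]; gcongr

end AreaOperator

end

theorem theorem1p3
    (μ : MeasureTheory.Measure AreaOperator.Disk) (ν : MeasureTheory.Measure AreaOperator.Torus)
    (ω : AreaOperator.Torus → ℝ≥0) (hω : AEMeasurable ω AreaOperator.arcLength)
    (hν0 : μ {z | ν (AreaOperator.Tent z) = 0} = 0)
    (hω0 : μ {z | AreaOperator.wMass ω (AreaOperator.Tent z) = 0} = 0)
    (hA1 : AreaOperator.IsA1 ω)
    (p q : ℝ) (hp : 0 < p) (hpq : p ≤ q) :
    AreaOperator.AreaOpBounded μ ν ω p q ↔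
      ∃ C : ℝ≥0, 0 < C ∧ ∀ I : Set AreaOperator.Torus, AreaOperator.IsArc I →
        AreaOperator.muNuOmega μ ν ω (AreaOperator.carlesonSquare I) ≤
          C * AreaOperator.wMass ω I ^ (1 + 1 / p - 1 / q) := by
  have hq : 0 < q := hp.trans_le hpq
  by_cases h0 : AreaOperator.weighted ω = 0
  · -- a weight which vanishes almost everywhere forces `μ = 0`
    have hμ : μ = 0 := by
      simpa [AreaOperator.wMass_eq, h0] using hω0
    refine iff_of_true ⟨1, one_pos, fun f g _ => ?_⟩ ⟨1, one_pos, fun I _ => ?_⟩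
    · have : AreaOperator.areaOp μ ν f = 0 := by ext ξ; simp [AreaOperator.areaOp, hμ]
      rw [this, AreaOperator.wNorm_eq hω, h0]
      simp [hq]
    · simp [AreaOperator.muNuOmega, hμ]
  have := hA1.isFiniteMeasure
  obtain ⟨D, hD⟩ := hA1.exists_doubling
  have ht : 0 ≤ 1 + 1 / p - 1 / q := by
    have := one_div_le_one_div_of_le hp hpq; linarith
  simp only [AreaOperator.wMass_eq]
  rw [AreaOperator.carleson_iff_box hD _ ht]
  constructor
  · intro h
    obtain ⟨C, hC⟩ := h.exists_lintegral_area_le hω hA1 hp hq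
    rw [AreaOperator.muNuOmega_eq]
    exact AreaOperator.carleson_of_area_le hD (hA1.weighted_tent_ne_zero h0) hp hpq rfl hC
  · rintro ⟨C, hC⟩
    exact AreaOperator.areaOpBounded_of_carleson hω hA1 h0 hp hpq ENNReal.coe_ne_top hC
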